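/- Let $r, n, m \ge 0$ be integers with $m \le n$, and let $W \sim \mathcal{W}_r(n, I_r)$ be a standard Wishart matrix, i.e. $W$ has the law of $XX^T$, where $X \in \mathbb{R}^{r \times n}$ has independent columns, each distributed according to the normal distribution $\mathcal{N}_r(0, I_r)$. Let $I, J, K, L \subseteq [r] = \{1, \dots, r\}$ be subsets of cardinality $m$ such that $I \triangle J = K \triangle L$, and put $$\bar I = I \setminus (I \cap J), \quad \bar J = J \setminus (I \cap J), \quad \bar K = K \setminus (K \cap L), \quad \bar L = L \setminus (K \cap L).$$ For $A, B \subseteq [r]$ and a total order on $[r]$, write $A < B$ if every element of $A$ is smaller than every element of $B$ (in particular whenever $A$ or $B$ is empty). Assume that a total order on $[r]$ (not necessarily the usual one) is given under which $$(I \cap J) \setminus (K \cap L) < \bar I, \qquad \bar I < \bar J, \qquad \bar J < (K \cap L) \setminus (I \cap J),$$ $$\bar I \cap \bar K < \bar I \cap \bar L, \qquad \bar J \cap \bar K < \bar J \cap \bar L,$$ and that the rows and columns of the submatrices $W_{I \times J}$ and $W_{K \times L}$ are listed in increasing order with respect to this total order. Then $\det(W_{I \times J}) \det(W_{K \times L})$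 is integrable and $$\mathbb{E}[\det(W_{I \times J}) \det(W_{K \times L})] = \frac{n!}{(n-m)!} \cdot \frac{(n+2)!}{(n+2 - |I \cap J \cap K \cap L|)!} \cdot \frac{(n-m + |(I \cap J) \setminus (K \cap L)|)!}{(n-m)!} \cdot |\bar I \cap \bar K|! \cdot |\bar I \cap \bar L|!.$$ -/

import Mathlib

open MeasureTheory ProbabilityTheory
open scoped Matrix Nat symmDiff

/-- Borel structure on matrices: the product σ-algebra of the entries. -/
instance Matrix.instMeasurableSpacePi {α β : Type*} : MeasurableSpace (Matrix α β ℝ) :=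
  MeasurableSpace.pi

/-- The matrix whose columns are the vectors `x 0, …, x (n - 1)`. -/
def columnMatrix {ι : Type*} {n : ℕ} (x : Fin n → EuclideanSpace ℝ ι) : Matrix ι (Fin n) ℝ :=
  Matrix.of fun i k => x k i

/-- The Wishart distribution with `n` degrees of freedom and scale parameter `S`: the law of
`X * Xᵀ`, where `X` has `n` independent columns, each distributed according to `𝒩(0, S)`. -/
noncomputable def wishart {ι : Type*} [Fintype ι] [DecidableEq ι] (n : ℕ) (S : Matrix ι ι ℝ) :
    Measure (Matrix ι ι ℝ) :=
  (Measure.pi fun _ : Fin n => multivariateGaussian (0 : EuclideanSpace ℝ ι) S).map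
    fun x => columnMatrix x * (columnMatrix x)ᵀ

/-- The minor `det (A_{I × J})`, for index sets `I`, `J` of cardinality `m`, with the rows and the
columns listed in increasing order with respect to the total order on the index type. -/
noncomputable def minor {ι : Type*} [LinearOrder ι] {m : ℕ} (A : Matrix ι ι ℝ) (I J : Finset ι)
    (hI : I.card = m) (hJ : J.card = m) : ℝ :=
  (A.submatrix (I.orderEmbOfFin hI) (J.orderEmbOfFin hJ)).det

/-- `A < B` for sets: every element of `A` is smaller than every element of `B`
(vacuously true if one of them is empty). -/
def SetLT {ι : Type*} [LinearOrder ι] (A B : Finset ι) : Prop :=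
  ∀ a ∈ A, ∀ b ∈ B, a < b

/-! `W` is the Gram matrix of the rows of `X`, which are independent standard Gaussian vectors in an
`n`-dimensional Euclidean space `E`. The expectation is computed for such Gram matrices by induction
on `|I ∩ J ∩ K ∩ L|`, with `E` varying.

If `x` lies in all four sets, condition on its vector `v`. The Schur complement of the entry `‖v‖²`
is the Gram matrix of the projections of the other vectors to `vᗮ`, which are again standard
Gaussian, in dimension `n - 1`. Each minor yields a factor `‖v‖²` and a sign; the signs cancel
because `I ∆ J = K ∆ L`. So `x` contributes `𝔼‖v‖⁴ = n (n + 2)` and `n`, `m` both drop by one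
(`integral_minor_gram_mul_minor_gram_erase`).

If no index is common to all four sets, every vector that occurs does so exactly twice, so the
product of minors is a quadratic form in each vector. By `integral_pi_stdGaussian` the expectation
is a sum over all assignments of orthonormal basis vectors. The Gram matrix of an assignment is a
0/1 matrix recording coincidences, and the product of the two determinants collapses to indicators
of injectivity times squares of two smaller determinants (`det_coincidenceMatrix_mul_det`); summing
is then counting injections and permutations. The order hypotheses make each sorted index set a
concatenation of blocks, so that both minors acquire the same sign when brought to this form. -/

/-! ### Rearranging products of one probability measure -/

/-- Restricting a product of copies of a probability measure along an injection. -/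
theorem measurePreserving_pi_comp {ι γ X : Type*} [Fintype ι] [Fintype γ] [MeasurableSpace X]
    (μ : Measure X) [IsProbabilityMeasure μ] {ρ : γ → ι} (hρ : ρ.Injective) :
    MeasurePreserving (fun (x : ι → X) (c : γ) => x (ρ c))
      (Measure.pi fun _ => μ) (Measure.pi fun _ => μ) := by
  refine ⟨by fun_prop, ?_⟩
  have h := (iIndepFun_pi (μ := fun _ : ι => μ) (X := fun _ x => x)
    (fun _ => aemeasurable_id)).precomp hρ
  have h2 := (iIndepFun_iff_map_fun_eq_pi_map
    (fun c => (measurable_pi_apply (ρ c)).aemeasurable)).1 h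
  refine h2.trans ?_
  congr with c : 1
  exact (measurePreserving_eval (fun _ : ι => μ) (ρ c)).map_eq

/-- Resampling one coordinate independently preserves the law; this is how a single Gaussian vector
is split off for conditioning. -/
theorem measurePreserving_pi_update {ι X : Type*} [Fintype ι] [DecidableEq ι] [MeasurableSpace X]
    (μ : Measure X) [IsProbabilityMeasure μ] (i : ι) :
    MeasurePreserving (fun p : X × (ι → X) => Function.update p.2 i p.1)
      (μ.prod (Measure.pi fun _ => μ)) (Measure.pi fun _ => μ) := by
  have hm : Measurable (fun p : X × (ι → X) => Function.update p.2 i p.1) := by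
    rw [measurable_pi_iff]
    intro j
    by_cases h : j = i
    · subst h; simpa using measurable_fst
    · simp only [Function.update_of_ne h]; fun_prop
  refine ⟨hm, (Measure.pi_eq fun s hs => ?_).symm⟩
  rw [Measure.map_apply hm (.univ_pi hs)]
  have : (fun p : X × (ι → X) => Function.update p.2 i p.1) ⁻¹' Set.univ.pi s =
      s i ×ˢ Set.univ.pi (Function.update s i Set.univ) := by
    ext ⟨v, g⟩
    simp only [Set.mem_preimage, Set.mem_pi, Set.mem_univ, true_imp_iff, Set.mem_prod]
    constructor
    · intro h
      refine ⟨by simpa using h i, fun j => ?_⟩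
      by_cases hj : j = i
      · subst hj; simp
      · simpa [hj] using h j
    · rintro ⟨h1, h2⟩ j
      by_cases hj : j = i
      · subst hj; simpa using h1
      · simpa [hj] using h2 j
  rw [this, Measure.prod_prod, Measure.pi_pi, ← Finset.mul_prod_erase _ _ (Finset.mem_univ i),
    ← Finset.mul_prod_erase _ (fun j => μ (s j)) (Finset.mem_univ i)]
  simp only [Function.update_self, measure_univ, one_mul]
  congr 1
  refine Finset.prod_congr rfl fun j hj => ?_
  rw [Function.update_of_ne (Finset.ne_of_mem_erase hj)]

theorem measurePreserving_pi_curry (α β : Type*) {X : Type*} [Fintype α] [Fintype β]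
    [MeasurableSpace X] (μ : Measure X) [IsProbabilityMeasure μ] :
    MeasurePreserving (MeasurableEquiv.curry α β X)
      (Measure.pi fun _ => μ) (Measure.pi fun _ => Measure.pi fun _ => μ) := by
  refine ⟨by fun_prop, ?_⟩
  have := Measure.infinitePi_map_curry (fun (_ : α) (_ : β) => μ)
  simpa only [Measure.infinitePi_eq_pi] using this

theorem measurePreserving_pi_swap {ι κ X : Type*} [Fintype ι] [Fintype κ] [MeasurableSpace X]
    (μ : Measure X) [IsProbabilityMeasure μ] :
    MeasurePreserving (fun (x : κ → ι → X) i k => x k i)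
      (Measure.pi fun _ => Measure.pi fun _ => μ) (Measure.pi fun _ => Measure.pi fun _ => μ) := by
  exact (measurePreserving_pi_curry ι κ μ).comp
    ((measurePreserving_pi_comp μ Prod.swap_injective).comp (measurePreserving_pi_curry κ ι μ).symm)

/-! ### Projections and moments of standard Gaussian vectors -/

theorem stdGaussian_map_orthogonalProjectionOnto {E : Type*} [NormedAddCommGroup E]
    [InnerProductSpace ℝ E] [FiniteDimensional ℝ E] [MeasurableSpace E] [BorelSpace E]
    (U : Submodule ℝ E) :
    (stdGaussian E).map U.orthogonalProjectionOnto = stdGaussian U := by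
  apply Measure.ext_of_charFun
  ext t
  rw [charFun_stdGaussian, charFun_apply, integral_map (by fun_prop) (by fun_prop)]
  have := charFun_stdGaussian (t : E)
  rw [charFun_apply] at this
  have hin (x : E) : inner ℝ (U.orthogonalProjectionOnto x) t = inner ℝ x (t : E) :=
    Submodule.inner_orthogonalProjectionOnto_eq_of_mem_right t x
  simp_rw [hin]
  exact this

theorem integral_inner_mul_inner_stdGaussian {E : Type*} [NormedAddCommGroup E]
    [InnerProductSpace ℝ E] [FiniteDimensional ℝ E] [MeasurableSpace E] [BorelSpace E] (u v : E) :
    ∫ x, inner ℝ u x * inner ℝ v x ∂(stdGaussian E) = inner ℝ u v := by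
  have h := covarianceBilin_apply_eq_cov (μ := stdGaussian E) (IsGaussian.memLp_two_id) u v
  rw [covarianceBilin_stdGaussian, covariance] at h
  have h0 (w : E) : ∫ x, inner ℝ w x ∂(stdGaussian E) = 0 :=
    integral_strongDual_stdGaussian (innerSL ℝ w)
  simp [h0] at h
  exact h.symm

theorem integral_sq_gaussianReal : ∫ x, x ^ 2 ∂(gaussianReal 0 1) = 1 := by
  have h := variance_fun_id_gaussianReal (μ := 0) (v := 1)
  rw [variance_eq_integral (by fun_prop)] at h
  simpa using h

theorem integrable_pow_gaussianReal (k : ℕ) : Integrable (fun x => x ^ k) (gaussianReal 0 1) := by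
  have h := (memLp_id_gaussianReal (μ := 0) (v := 1) k).integrable_norm_pow'
  refine h.mono' (by fun_prop) (ae_of_all _ fun x => ?_)
  simp

/-- Compare the fourth moments of `x + y` and `√2 x`, which have the same law. -/
theorem integral_pow_four_gaussianReal : ∫ x, x ^ 4 ∂(gaussianReal 0 1) = 3 := by
  set γ := gaussianReal 0 1 with hγ
  set M := ∫ x, x ^ 4 ∂γ with hM
  have hI (i j : ℕ) : Integrable (fun p : ℝ × ℝ => p.1 ^ i * p.2 ^ j) (γ.prod γ) :=
    (integrable_pow_gaussianReal i).mul_prod (integrable_pow_gaussianReal j)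
  have hE (i j : ℕ) : ∫ p : ℝ × ℝ, p.1 ^ i * p.2 ^ j ∂(γ.prod γ) =
      (∫ x, x ^ i ∂γ) * ∫ x, x ^ j ∂γ := integral_prod_mul (fun x => x ^ i) (fun x => x ^ j)
  have h1 : ∫ p : ℝ × ℝ, (p.1 + p.2) ^ 4 ∂(γ.prod γ) = 2 * M + 6 := by
    have : ∀ p : ℝ × ℝ, (p.1 + p.2) ^ 4 = (p.1 ^ 4 * p.2 ^ 0 + p.1 ^ 0 * p.2 ^ 4)
        + (4 * (p.1 ^ 3 * p.2 ^ 1) + 4 * (p.1 ^ 1 * p.2 ^ 3)) + 6 * (p.1 ^ 2 * p.2 ^ 2) :=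
      fun p => by ring
    simp_rw [this]
    rw [integral_add (by fun_prop) (by fun_prop), integral_add (by fun_prop) (by fun_prop),
      integral_add (by fun_prop) (by fun_prop), integral_add (by fun_prop) (by fun_prop)]
    simp only [integral_const_mul, hE]
    have h2 : ∫ x, x ^ 2 ∂γ = 1 := integral_sq_gaussianReal
    have h1 : ∫ x, x ^ 1 ∂γ = 0 := by simp [hγ]
    rw [h1, h2, ← hM]
    simp
    ring
  have h2 : ∫ p : ℝ × ℝ, (p.1 + p.2) ^ 4 ∂(γ.prod γ) = 4 * M := by
    have hc : (γ.prod γ).map (fun p : ℝ × ℝ => p.1 + p.2) = γ.map (fun x => √2 * x) := by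
      have := gaussianReal_conv_gaussianReal (m₁ := 0) (m₂ := 0) (v₁ := 1) (v₂ := 1)
      rw [Measure.conv] at this
      rw [this, gaussianReal_map_const_mul]
      congr 1
      · simp
      · ext; norm_num
    have hm : AEMeasurable (fun p : ℝ × ℝ => p.1 + p.2) (γ.prod γ) := by fun_prop
    rw [← integral_map hm (f := fun x : ℝ => x ^ 4) (by fun_prop), hc,
      integral_map (by fun_prop) (by fun_prop)]
    simp_rw [mul_pow, integral_const_mul]
    rw [show √2 ^ 4 = (√2 ^ 2) ^ 2 by ring, Real.sq_sqrt (by norm_num)]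
    norm_num [hM]
  linarith

theorem integral_norm_pow_four_stdGaussian (E : Type*) [NormedAddCommGroup E]
    [InnerProductSpace ℝ E] [FiniteDimensional ℝ E] [MeasurableSpace E] [BorelSpace E] :
    ∫ v, ‖v‖ ^ 4 ∂(stdGaussian E) =
      (Module.finrank ℝ E : ℝ) * (Module.finrank ℝ E + 2) := by
  rw [stdGaussian, integral_map (Measurable.aemeasurable (by fun_prop)) (by fun_prop)]
  set n := Module.finrank ℝ E
  have hn (x : Fin n → ℝ) : ‖∑ i, x i • stdOrthonormalBasis ℝ E i‖ ^ 4 =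
      ∑ i, ∑ j, x i ^ 2 * x j ^ 2 := by
    rw [← Finset.sum_mul_sum, ← sq, show 4 = 2 * 2 from rfl, pow_mul]
    congr 1
    rw [← (stdOrthonormalBasis ℝ E).sum_sq_inner_right]
    refine Finset.sum_congr rfl fun i _ => ?_
    simp [inner_sum, inner_smul_right, (stdOrthonormalBasis ℝ E).inner_eq_ite, n]
  -- Written as a product over all coordinates, with exponents 0, 2 or 4, the monomial can be
  -- integrated factor by factor.
  have hprod (i j : Fin n) (x : Fin n → ℝ) : x i ^ 2 * x j ^ 2 =
      ∏ k, x k ^ ((if k = i then 2 else 0) + if k = j then 2 else 0) := by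
    simp_rw [pow_add, Finset.prod_mul_distrib, pow_ite, pow_zero]
    simp
  have hint (i j : Fin n) : Integrable (fun x : Fin n → ℝ => x i ^ 2 * x j ^ 2)
      (Measure.pi fun _ => gaussianReal 0 1) := by
    simp_rw [hprod]
    exact Integrable.fintype_prod (fun k => integrable_pow_gaussianReal _)
  -- On the diagonal the value is the fourth moment `3 = 1 + 2`; summing over all pairs gives `n² +
  -- 2n`.
  have hval (i j : Fin n) : ∫ x : Fin n → ℝ, x i ^ 2 * x j ^ 2
      ∂(Measure.pi fun _ => gaussianReal 0 1) = 1 + if i = j then 2 else 0 := by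
    simp_rw [hprod]
    rw [integral_fintype_prod_eq_prod
      (fun k x => x ^ ((if k = i then 2 else 0) + if k = j then 2 else 0))]
    by_cases hij : i = j
    · subst hij
      rw [Finset.prod_eq_single i]
      · simp [integral_pow_four_gaussianReal]; norm_num
      · intro k _ hk; simp [hk]
      · simp
    · rw [Finset.prod_eq_one]
      · simp [hij]
      · intro k _
        by_cases h1 : k = i
        · subst h1; simp [hij, integral_sq_gaussianReal]
        · by_cases h2 : k = j
          · subst h2; simp [h1, integral_sq_gaussianReal]
          · simp [h1, h2]
  rw [integral_congr_ae (ae_of_all _ hn), integral_finsetSum _ fun i _ =>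
    integrable_finsetSum _ fun j _ => hint i j]
  have hin (i : Fin n) := integral_finsetSum Finset.univ fun j _ => hint i j
  rw [Finset.sum_congr rfl fun i _ => hin i]
  simp_rw [hval]
  simp only [Finset.sum_add_distrib, Finset.sum_ite_eq, Finset.sum_const, Finset.mem_univ, if_true,
    Finset.card_univ, Fintype.card_fin, nsmul_eq_mul, mul_one]
  ring

/-! ### Expectations of functions quadratic in each Gaussian vector -/

section Wick

variable {E : Type*} [NormedAddCommGroup E] [InnerProductSpace ℝ E]

/-- The linear functionals `x ↦ ⟪u, x⟫`, as a submodule of the algebra of functions on `E`; its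
`d`-th power consists of the homogeneous polynomial functions of degree `d`. -/
noncomputable def innerFunctionals (E : Type*) [NormedAddCommGroup E] [InnerProductSpace ℝ E] :
    Submodule ℝ (E → ℝ) :=
  LinearMap.range (LinearMap.pi fun x : E => (innerₗ E).flip x)

theorem mem_innerFunctionals_iff {f : E → ℝ} :
    f ∈ innerFunctionals E ↔ ∃ u, f = fun x => inner ℝ u x := by
  simp only [innerFunctionals, LinearMap.mem_range]
  exact exists_congr fun u => eq_comm

theorem inner_left_mem_innerFunctionals (u : E) :
    (fun x => inner ℝ u x) ∈ innerFunctionals E := mem_innerFunctionals_iff.2 ⟨u, rfl⟩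

theorem norm_sq_mem_innerFunctionals_sq [FiniteDimensional ℝ E] :
    (fun x : E => inner ℝ x x) ∈ innerFunctionals E ^ 2 := by
  have : (fun x : E => inner ℝ x x) = ∑ i, (fun x => inner ℝ (stdOrthonormalBasis ℝ E i) x) *
      (fun x => inner ℝ (stdOrthonormalBasis ℝ E i) x) := by
    ext x
    rw [← (stdOrthonormalBasis ℝ E).sum_inner_mul_inner x x]
    simp [real_inner_comm x]
  rw [this, pow_two]
  exact Submodule.sum_mem _ fun i _ => Submodule.mul_mem_mul
    (inner_left_mem_innerFunctionals _) (inner_left_mem_innerFunctionals _)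

variable [FiniteDimensional ℝ E] [MeasurableSpace E] [BorelSpace E]
  {κ : Type*} [Fintype κ] (b : OrthonormalBasis κ ℝ E)

/-- For a product of two functionals `⟪u, ·⟫` and `⟪v, ·⟫` both sides equal `⟪u, v⟫`, the right one
by Parseval; linearity does the rest. -/
theorem integrable_and_integral_of_mem_innerFunctionals_sq {f : E → ℝ}
    (hf : f ∈ innerFunctionals E ^ 2) :
    Integrable f (stdGaussian E) ∧ ∫ x, f x ∂(stdGaussian E) = ∑ s, f (b s) := by
  rw [pow_two] at hf
  refine Submodule.mul_induction_on (C := fun f => Integrable f (stdGaussian E) ∧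
    ∫ x, f x ∂(stdGaussian E) = ∑ s, f (b s)) hf (fun f hf g hg => ?_) fun f g hf hg => ?_
  · obtain ⟨u, rfl⟩ := mem_innerFunctionals_iff.1 hf
    obtain ⟨v, rfl⟩ := mem_innerFunctionals_iff.1 hg
    have hL (w : E) : MemLp (fun x => inner ℝ w x) 2 (stdGaussian E) :=
      IsGaussian.memLp_two_id.const_inner w
    refine ⟨(hL u).integrable_mul (hL v), ?_⟩
    simp only [Pi.mul_apply]
    rw [integral_inner_mul_inner_stdGaussian, ← b.sum_inner_mul_inner]
    simp [real_inner_comm v]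
  · refine ⟨hf.1.add hg.1, ?_⟩
    simp only [Pi.add_apply]
    rw [integral_add hf.1 hg.1, hf.2, hg.2, Finset.sum_add_distrib]

/-- Fubini, one vector at a time: fixing the others leaves a quadratic form in a single vector. -/
theorem integral_pi_fin_stdGaussian (N : ℕ) (F : (Fin N → E) → ℝ)
    (hF : Integrable F (Measure.pi fun _ => stdGaussian E))
    (hq : ∀ g i, (fun y => F (Function.update g i y)) ∈ innerFunctionals E ^ 2) :
    ∫ g, F g ∂(Measure.pi fun _ => stdGaussian E) = ∑ f : Fin N → κ, F (b ∘ f) := by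
  induction N with
  | zero =>
    rw [Measure.pi_of_empty, integral_dirac]
    simp only [Finset.univ_unique, Finset.sum_singleton]
    congr
    subsingleton
  | succ N ih =>
    have hmp := (measurePreserving_piFinSuccAbove (fun _ : Fin (N + 1) => stdGaussian E) 0).symm
    have hcons (v : E) (g : Fin N → E) :
        (MeasurableEquiv.piFinSuccAbove (fun _ : Fin (N + 1) => E) 0).symm (v, g) =
          Fin.cons v g := by
      simp only [MeasurableEquiv.piFinSuccAbove_symm_apply, Fin.insertNthEquiv_zero]
      rfl
    rw [← hmp.integral_comp', integral_prod]
    swap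
    · exact hmp.integrable_comp_of_integrable hF
    simp only [hcons]
    have hsec := (hmp.integrable_comp_of_integrable hF).prod_right_ae
    -- Fubini makes the sections integrable only for almost every `v`, which suffices under the
    -- outer integral.
    have : ∀ᵐ v ∂(stdGaussian E), ∫ g, F (Fin.cons v g) ∂(Measure.pi fun _ => stdGaussian E) =
        ∑ f : Fin N → κ, F (Fin.cons v (b ∘ f)) := by
      filter_upwards [hsec] with v hv
      refine ih (fun g => F (Fin.cons v g)) ?_ fun g i => ?_
      · simpa only [Function.comp_def, hcons] using hv
      · simpa only [Fin.cons_update] using hq (Fin.cons v g) i.succ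
    rw [integral_congr_ae this]
    have hz (f : Fin N → κ) : (fun v => F (Fin.cons v (b ∘ f))) ∈ innerFunctionals E ^ 2 := by
      simpa only [Fin.update_cons_zero] using hq (Fin.cons 0 (b ∘ f)) 0
    rw [integral_finsetSum _ fun f _ =>
      (integrable_and_integral_of_mem_innerFunctionals_sq b (hz f)).1,
      Finset.sum_congr rfl fun f _ =>
      (integrable_and_integral_of_mem_innerFunctionals_sq b (hz f)).2, Finset.sum_comm,
      ← Fintype.sum_prod_type']
    refine Fintype.sum_equiv (Fin.consEquiv fun _ => κ) _ _ fun p => ?_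
    congr 1
    ext i
    refine Fin.cases ?_ (fun i => ?_) i <;> simp [Fin.consEquiv]

/-- A function of independent standard Gaussian vectors that is a quadratic form in each of them:
the expectation is obtained by letting each vector run through an orthonormal basis. -/
theorem integral_pi_stdGaussian {γ : Type*} [Fintype γ] [DecidableEq γ] (F : (γ → E) → ℝ)
    (hF : Integrable F (Measure.pi fun _ => stdGaussian E))
    (hq : ∀ g i, (fun y => F (Function.update g i y)) ∈ innerFunctionals E ^ 2) :
    ∫ g, F g ∂(Measure.pi fun _ => stdGaussian E) = ∑ f : γ → κ, F (b ∘ f) := by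
  let e := Fintype.equivFin γ
  have hmp := measurePreserving_pi_comp (stdGaussian E) e.injective
  rw [← hmp.map_eq, integral_map hmp.measurable.aemeasurable (by
    rw [hmp.map_eq]; exact hF.aestronglyMeasurable)]
  rw [integral_pi_fin_stdGaussian b (Fintype.card γ) (fun x => F fun c => x (e c))
    (hmp.integrable_comp_of_integrable hF)]
  · exact Fintype.sum_equiv (e.arrowCongr (Equiv.refl κ)).symm _ _ fun f => rfl
  · intro g i
    convert hq (fun c => g (e c)) (e.symm i) using 3 with y
    ext c
    by_cases hc : c = e.symm i
    · subst hc; simp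
    · have : e c ≠ i := fun h => hc (by simp [← h])
      simp [hc, this]

end Wick

/-! ### Integrability of products of Gram minors -/

section Bounds

variable {ι : Type*} [Fintype ι] {E : Type*} [NormedAddCommGroup E] [InnerProductSpace ℝ E]
  [FiniteDimensional ℝ E] [MeasurableSpace E] [BorelSpace E]

/-- A family of independent Gaussian vectors is jointly Gaussian, hence has moments of every order.
-/
theorem integrable_norm_pow_pi_stdGaussian (k : ℕ) :
    Integrable (fun g : ι → E => ‖g‖ ^ k) (Measure.pi fun _ => stdGaussian E) := by
  have hind := iIndepFun_pi (μ := fun _ : ι => stdGaussian E) (X := fun _ x => x)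
    (fun _ => aemeasurable_id)
  have hG := hind.hasGaussianLaw fun i => ⟨by
    rw [show (fun ω : ι → E => ω i) = Function.eval i from rfl,
      (measurePreserving_eval (fun _ : ι => stdGaussian E) i).map_eq]; infer_instance⟩
  have h := hG.memLp (p := k) (by simp)
  exact h.integrable_norm_pow'

theorem abs_det_gram_submatrix_le {ι E δ : Type*} [Fintype ι] [NormedAddCommGroup E]
    [InnerProductSpace ℝ E] [Fintype δ] [DecidableEq δ] (u v : δ → ι) (g : ι → E) :
    |((Matrix.gram ℝ g).submatrix u v).det| ≤
      (Fintype.card δ)! * ‖g‖ ^ (2 * Fintype.card δ) := by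
  have := Matrix.det_le (A := (Matrix.gram ℝ g).submatrix u v) (abv := AbsoluteValue.abs)
    (x := ‖g‖ ^ 2) (fun i j => by
      simp only [Matrix.submatrix_apply, Matrix.gram_apply, AbsoluteValue.abs_apply]
      refine (abs_real_inner_le_norm _ _).trans ?_
      rw [sq]
      gcongr <;> exact norm_le_pi_norm g _)
  simpa [pow_mul] using this

theorem continuous_det_gram_submatrix {ι E δ : Type*} [NormedAddCommGroup E]
    [InnerProductSpace ℝ E] [Fintype δ] [DecidableEq δ] (u v : δ → ι) :
    Continuous fun g : ι → E => ((Matrix.gram ℝ g).submatrix u v).det := by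
  refine Continuous.matrix_det (continuous_matrix fun i j => ?_)
  simp only [Matrix.submatrix_apply, Matrix.gram_apply]
  fun_prop

/-- By Cauchy–Schwarz each entry is at most `‖g‖²` in the sup norm, so the product is dominated by a
constant times a power of `‖g‖`. -/
theorem integrable_det_mul_det_gram {α β : Type*} [Fintype α] [DecidableEq α] [Fintype β]
    [DecidableEq β] (u v : α → ι) (w z : β → ι) :
    Integrable (fun g : ι → E => ((Matrix.gram ℝ g).submatrix u v).det *
      ((Matrix.gram ℝ g).submatrix w z).det) (Measure.pi fun _ => stdGaussian E) := by
  refine ((integrable_norm_pow_pi_stdGaussian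
    (2 * Fintype.card α + 2 * Fintype.card β)).const_mul
      ((Fintype.card α)! * (Fintype.card β)! : ℝ)).mono'
    ((continuous_det_gram_submatrix u v).mul
      (continuous_det_gram_submatrix w z)).aestronglyMeasurable (ae_of_all _ fun g => ?_)
  rw [Real.norm_eq_abs, abs_mul]
  refine (mul_le_mul (abs_det_gram_submatrix_le u v g)
    (abs_det_gram_submatrix_le w z g) (abs_nonneg _) (by positivity)).trans_eq ?_
  ring

end Bounds

/-! ### Degree of a Gram minor in one of the vectors -/

section Degree

variable {E : Type*} [NormedAddCommGroup E] [InnerProductSpace ℝ E] [FiniteDimensional ℝ E]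

theorem inner_update_mem_innerFunctionals_pow {γ : Type*} [DecidableEq γ] (g : γ → E) (x i j : γ) :
    (fun y => inner ℝ (Function.update g x y i) (Function.update g x y j)) ∈
      innerFunctionals E ^ ((if i = x then 1 else 0) + if j = x then 1 else 0) := by
  by_cases hi : i = x <;> by_cases hj : j = x
  · subst hi; subst hj
    simpa using norm_sq_mem_innerFunctionals_sq
  · subst hi
    simpa [hj, real_inner_comm] using inner_left_mem_innerFunctionals (g j)
  · subst hj
    simpa [hi] using inner_left_mem_innerFunctionals (g i)
  · simp only [Function.update_of_ne hi, Function.update_of_ne hj, hi, hj, if_false, add_zero,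
      pow_zero]
    exact Submodule.mem_one.2 ⟨inner ℝ (g i) (g j), rfl⟩

theorem prod_mem_pow_sum {R A α : Type*} [CommSemiring R] [CommSemiring A] [Algebra R A]
    (L : Submodule R A) (s : Finset α) (f : α → A) (d : α → ℕ) (h : ∀ a ∈ s, f a ∈ L ^ d a) :
    ∏ a ∈ s, f a ∈ L ^ ∑ a ∈ s, d a := by
  classical
  induction s using Finset.induction_on with
  | empty => simpa using Submodule.mem_one.2 ⟨1, map_one _⟩
  | insert a s ha ih =>
    rw [Finset.prod_insert ha, Finset.sum_insert ha, pow_add]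
    exact Submodule.mul_mem_mul (h a (by simp)) (ih fun c hc => h c (by simp [hc]))

/-- Every term of the Leibniz expansion uses each row and each column once, so all terms have the
same degree in the vector at `x`: the number of times `x` labels a row or a column. -/
theorem det_gram_update_mem_innerFunctionals_pow {γ α : Type*} [DecidableEq γ] [Fintype α]
    [DecidableEq α] (u v : α → γ) (g : γ → E) (x : γ) :
    (fun y => ((Matrix.gram ℝ (Function.update g x y)).submatrix u v).det) ∈
      innerFunctionals E ^
        ((∑ a, if u a = x then 1 else 0) + ∑ a, if v a = x then 1 else 0) := by
  have : (fun y => ((Matrix.gram ℝ (Function.update g x y)).submatrix u v).det) =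
      ∑ σ : Equiv.Perm α, (Equiv.Perm.sign σ : ℤ) • ∏ a, fun y =>
        inner ℝ (Function.update g x y (u (σ a))) (Function.update g x y (v a)) := by
    ext y
    simp [Matrix.det_apply, Units.smul_def]
  rw [this]
  refine Submodule.sum_mem _ fun σ _ => ?_
  refine zsmul_mem ?_ _
  have := prod_mem_pow_sum (innerFunctionals E) Finset.univ _ _ fun a _ =>
    inner_update_mem_innerFunctionals_pow g x (u (σ a)) (v a)
  rwa [Finset.sum_add_distrib, Equiv.sum_comp σ (fun a => if u a = x then 1 else 0)] at this

end Degree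

/-! ### Schur complements of minors and their signs -/

section Schur

/-- Expansion of a determinant by the Schur complement of a nonzero entry. -/
theorem det_eq_mul_det_schur {R : Type*} [Field R] {k : ℕ} (A : Matrix (Fin (k + 1)) (Fin (k + 1)) R)
    (i j : Fin (k + 1)) (h : A i j ≠ 0) :
    A.det = (-1) ^ (i + j : ℕ) * A i j * (Matrix.of fun a c => A (i.succAbove a) (j.succAbove c) -
      A (i.succAbove a) j * A i (j.succAbove c) / A i j).det := by
  -- Multiples of row `i` are subtracted from the other rows to clear column `j` outside row `i`.
  let B : Matrix (Fin (k + 1)) (Fin (k + 1)) R :=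
    Matrix.of fun a c => if a = i then A i c else A a c - A a j * A i c / A i j
  have hAB : A.det = B.det := by
    refine Matrix.det_eq_of_forall_row_eq_smul_add_const
      (fun a => if a = i then 0 else A a j / A i j) i (by simp) fun a c => ?_
    by_cases ha : a = i
    · subst ha; simp [B]
    · simp [B, ha]; ring
  rw [hAB, Matrix.det_succ_column B j, Finset.sum_eq_single i]
  · congr 2
    · simp [B]
    · ext a c
      simp [B]
  · intro a _ ha
    simp [B, ha, h]
  · simp

variable {ι : Type*} [LinearOrder ι]

theorem orderEmbOfFin_erase {s : Finset ι} {k : ℕ} (h : s.card = k + 1) (i : Fin (k + 1))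
    (h' : (s.erase (s.orderEmbOfFin h i)).card = k) (a : Fin k) :
    s.orderEmbOfFin h (i.succAbove a) = (s.erase (s.orderEmbOfFin h i)).orderEmbOfFin h' a := by
  refine congrFun (Finset.orderEmbOfFin_unique h' (f := fun a => s.orderEmbOfFin h (i.succAbove a))
    (fun a => ?_) ?_) a
  · simp [Finset.mem_erase, Fin.succAbove_ne]
  · exact (s.orderEmbOfFin h).strictMono.comp (Fin.strictMono_succAbove i)

theorem card_filter_lt_orderEmbOfFin {s : Finset ι} {k : ℕ} (h : s.card = k) (i : Fin k) :
    (s.filter (· < s.orderEmbOfFin h i)).card = i := by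
  have : s.filter (· < s.orderEmbOfFin h i) =
      (Finset.Iio i).map (s.orderEmbOfFin h).toEmbedding := by
    ext y
    simp only [Finset.mem_filter, Finset.mem_map, Finset.mem_Iio]
    constructor
    · rintro ⟨hy, hlt⟩
      have : y ∈ Set.range (s.orderEmbOfFin h) := by simpa using hy
      obtain ⟨j, rfl⟩ := this
      exact ⟨j, by simpa using hlt, rfl⟩
    · rintro ⟨j, hj, rfl⟩
      exact ⟨s.orderEmbOfFin_mem h j, by simpa using hj⟩
  rw [this, Finset.card_map, Fin.card_Iio]

theorem exists_orderEmbOfFin_eq {s : Finset ι} {k : ℕ} (h : s.card = k) {x : ι} (hx : x ∈ s) :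
    ∃ i, s.orderEmbOfFin h i = x := by
  have : x ∈ Set.range (s.orderEmbOfFin h) := by simpa using hx
  exact this

/-- The position of `x` in a sorted set is the number of smaller elements, whence the sign. `M'` is
prescribed only away from `x`, so it may be a Gram matrix still indexed by all of `ι`. -/
theorem minor_eq_mul_minor_schur {M M' : Matrix ι ι ℝ} {x : ι} (hM : M x x ≠ 0)
    (hM' : ∀ i j, i ≠ x → j ≠ x → M' i j = M i j - M i x * M x j / M x x)
    {I J : Finset ι} {k : ℕ} (hI : I.card = k + 1) (hJ : J.card = k + 1)
    (hxI : x ∈ I) (hxJ : x ∈ J) (hI' : (I.erase x).card = k) (hJ' : (J.erase x).card = k) :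
    minor M I J hI hJ = (-1) ^ ((I.filter (· < x)).card + (J.filter (· < x)).card) * M x x *
      minor M' (I.erase x) (J.erase x) hI' hJ' := by
  obtain ⟨i, hi⟩ := exists_orderEmbOfFin_eq hI hxI
  obtain ⟨j, hj⟩ := exists_orderEmbOfFin_eq hJ hxJ
  have ci := card_filter_lt_orderEmbOfFin hI i
  have cj := card_filter_lt_orderEmbOfFin hJ j
  have ei := orderEmbOfFin_erase hI i
  have ej := orderEmbOfFin_erase hJ j
  simp only [hi] at ci ei
  simp only [hj] at cj ej
  have hne (s : Finset ι) (h : (s.erase x).card = k) (a : Fin k) :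
      (s.erase x).orderEmbOfFin h a ≠ x := Finset.ne_of_mem_erase (Finset.orderEmbOfFin_mem _ h a)
  rw [minor, det_eq_mul_det_schur _ i j (by simpa [hi, hj] using hM), ci, cj, minor]
  simp only [Matrix.submatrix_apply, hi, hj]
  congr 2
  ext a c
  simp only [Matrix.of_apply, Matrix.submatrix_apply, ei hI', ej hJ']
  rw [hM' _ _ (hne I hI' a) (hne J hJ' c)]

theorem minor_eq_zero_of_row {M : Matrix ι ι ℝ} {x : ι} (hM : ∀ j, M x j = 0)
    {I J : Finset ι} {k : ℕ} (hI : I.card = k) (hJ : J.card = k) (hxI : x ∈ I) :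
    minor M I J hI hJ = 0 := by
  obtain ⟨i, hi⟩ := exists_orderEmbOfFin_eq hI hxI
  exact Matrix.det_eq_zero_of_row_eq_zero i fun j => by simp [hi, hM]

/-- Modulo 2, the sum of the counts in `I` and `J` is the count in `I ∆ J`. Applied to `· < x`, this
cancels the signs of the two Schur expansions. -/
theorem even_card_filter_of_symmDiff_eq {I J K L : Finset ι} (h : I ∆ J = K ∆ L)
    (p : ι → Prop) [DecidablePred p] :
    Even ((I.filter p).card + (J.filter p).card + ((K.filter p).card + (L.filter p).card)) := by
  have key (S T : Finset ι) : (S.filter p).card + (T.filter p).card =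
      ((S ∆ T).filter p).card + 2 * ((S ∩ T).filter p).card := by
    have e1 : S.filter p = (S \ T).filter p ∪ (S ∩ T).filter p := by
      rw [← Finset.filter_union, Finset.sdiff_union_inter]
    have e2 : T.filter p = (T \ S).filter p ∪ (S ∩ T).filter p := by
      rw [← Finset.filter_union, Finset.inter_comm, Finset.sdiff_union_inter]
    have e3 : (S ∆ T).filter p = (S \ T).filter p ∪ (T \ S).filter p := by
      rw [← Finset.filter_union]; rfl
    have d1 : Disjoint ((S \ T).filter p) ((S ∩ T).filter p) :=
      Finset.disjoint_filter_filter (Finset.disjoint_sdiff_inter S T)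
    have d2 : Disjoint ((T \ S).filter p) ((S ∩ T).filter p) := by
      rw [Finset.inter_comm]
      exact Finset.disjoint_filter_filter (Finset.disjoint_sdiff_inter T S)
    have d3 : Disjoint ((S \ T).filter p) ((T \ S).filter p) :=
      Finset.disjoint_filter_filter disjoint_sdiff_sdiff
    rw [e3, e1, e2, Finset.card_union_of_disjoint d1, Finset.card_union_of_disjoint d2,
      Finset.card_union_of_disjoint d3]
    rw [← e1, ← e2] at *
    ring
  rw [key I J, key K L, h]
  exact ⟨((K ∆ L).filter p).card + ((I ∩ J).filter p).card + ((K ∩ L).filter p).card, by ring⟩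

end Schur

/-! ### Determinants of 0/1 coincidence matrices and their sums -/

section Coincidence

variable {κ : Type*} [DecidableEq κ]

/-- The matrix with an entry `1` where `u` and `v` agree, and `0` elsewhere. -/
def coincidenceMatrix {α β : Type*} (u : α → κ) (v : β → κ) : Matrix α β ℝ :=
  Matrix.of fun a c => if u a = v c then 1 else 0

theorem coincidenceMatrix_transpose {α β : Type*} (u : α → κ) (v : β → κ) :
    (coincidenceMatrix u v)ᵀ = coincidenceMatrix v u := by
  ext a c; simp [coincidenceMatrix, eq_comm]

theorem coincidenceMatrix_sumElim {α β α' β' : Type*} (a : α → κ) (b : β → κ) (c : α' → κ)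
    (d : β' → κ) : coincidenceMatrix (Sum.elim a b) (Sum.elim c d) =
      Matrix.fromBlocks (coincidenceMatrix a c) (coincidenceMatrix a d)
        (coincidenceMatrix b c) (coincidenceMatrix b d) := by
  ext (i | i) (j | j) <;> rfl

theorem coincidenceMatrix_eq_zero {α β : Type*} {u : α → κ} {v : β → κ} (h : ∀ a c, u a ≠ v c) :
    coincidenceMatrix u v = 0 := by
  ext a c; simp [coincidenceMatrix, h]

theorem coincidenceMatrix_self {α : Type*} [DecidableEq α] {u : α → κ} (h : u.Injective) :
    coincidenceMatrix u u = 1 := by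
  ext a c; simp [coincidenceMatrix, Matrix.one_apply, h.eq_iff]

variable {α β : Type*} [Fintype α] [DecidableEq α] [Fintype β] [DecidableEq β]

theorem det_coincidenceMatrix_comm (u v : α → κ) :
    (coincidenceMatrix u v).det = (coincidenceMatrix v u).det := by
  rw [← Matrix.det_transpose, coincidenceMatrix_transpose]

theorem injective_left_of_det_coincidenceMatrix_ne_zero {u v : α → κ}
    (h : (coincidenceMatrix u v).det ≠ 0) : u.Injective := by
  intro a c hac
  by_contra hne
  exact h (Matrix.det_zero_of_row_eq hne (by ext; simp [coincidenceMatrix, hac]))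

theorem injective_right_of_det_coincidenceMatrix_ne_zero {u v : α → κ}
    (h : (coincidenceMatrix u v).det ≠ 0) : v.Injective :=
  injective_left_of_det_coincidenceMatrix_ne_zero (by rwa [det_coincidenceMatrix_comm])

theorem exists_eq_of_det_coincidenceMatrix_ne_zero {u v : α → κ}
    (h : (coincidenceMatrix u v).det ≠ 0) (c : α) : ∃ a, u a = v c := by
  by_contra! hne
  exact h (Matrix.det_eq_zero_of_column_eq_zero c fun a => by simp [coincidenceMatrix, hne a])

/-- A zero row or column kills the determinant, so `u` and `v` must have the same range. -/
theorem forall_ne_iff_of_det_coincidenceMatrix_ne_zero {u v : α → κ}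
    (h : (coincidenceMatrix u v).det ≠ 0) (y : κ) : (∀ a, y ≠ u a) ↔ ∀ a, y ≠ v a := by
  constructor
  · intro hy a e
    obtain ⟨c, hc⟩ := exists_eq_of_det_coincidenceMatrix_ne_zero h a
    exact hy c (e.trans hc.symm)
  · intro hy a e
    rw [det_coincidenceMatrix_comm] at h
    obtain ⟨c, hc⟩ := exists_eq_of_det_coincidenceMatrix_ne_zero h a
    exact hy c (e.trans hc.symm)

theorem sumElim_injective_iff {α β κ : Type*} {a : α → κ} {b : β → κ} :
    (Sum.elim a b).Injective ↔ a.Injective ∧ b.Injective ∧ ∀ x y, a x ≠ b y := by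
  constructor
  · intro h
    exact ⟨fun x y e => Sum.inl_injective (h (by simpa using e)),
      fun x y e => Sum.inr_injective (h (by simpa using e)),
      fun x y e => by simpa using h (a₁ := Sum.inl x) (a₂ := Sum.inr y) (by simpa using e)⟩
  · rintro ⟨h1, h2, h3⟩
    exact h1.sumElim h2 h3

-- If the row labels are injective, the matrix is block triangular with an identity block; otherwise
-- two rows agree.
open Classical in
theorem det_coincidenceMatrix_sumElim_same (a : α → κ) (g h : β → κ) :
    (coincidenceMatrix (Sum.elim a g) (Sum.elim a h)).det =
      (if (Sum.elim a g).Injective then 1 else 0) * (coincidenceMatrix g h).det := by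
  split_ifs with hi
  · have := sumElim_injective_iff.1 hi
    rw [coincidenceMatrix_sumElim, coincidenceMatrix_eq_zero (u := g) (v := a)
      fun x y => (this.2.2 y x).symm, Matrix.det_fromBlocks_zero₂₁, coincidenceMatrix_self this.1,
      Matrix.det_one]
  · rw [zero_mul]
    by_contra h
    exact hi (injective_left_of_det_coincidenceMatrix_ne_zero h)

theorem det_coincidenceMatrix_sumElim_of_ne {a a' : α → κ} {b b' : β → κ}
    (h : ∀ x y, a x ≠ b' y) :
    (coincidenceMatrix (Sum.elim a b) (Sum.elim a' b')).det =
      (coincidenceMatrix a a').det * (coincidenceMatrix b b').det := by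
  rw [coincidenceMatrix_sumElim, coincidenceMatrix_eq_zero h, Matrix.det_fromBlocks_zero₁₂]

-- If the left side is nonzero, the rows of the second matrix force `f₁` and `f₃` to have disjoint
-- ranges, so the first matrix is block triangular and its determinant splits. Then `f₂` and `f₃`
-- share their range, as do `f₁` and `f₄`, so the second determinant splits into the same two
-- factors, producing squares.
open Classical in
theorem det_coincidenceMatrix_mul_det {δ : Type*} [Fintype δ] [DecidableEq δ]
    (c d : δ → κ) (f₁ f₄ : α → κ) (f₂ f₃ : β → κ) :
    (coincidenceMatrix (Sum.elim c (Sum.elim f₁ f₂)) (Sum.elim c (Sum.elim f₄ f₃))).det *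
      (coincidenceMatrix (Sum.elim d (Sum.elim f₁ f₃)) (Sum.elim d (Sum.elim f₄ f₂))).det =
    (if (Sum.elim c (Sum.elim f₁ f₂)).Injective then 1 else 0) *
      (if (Sum.elim d (Sum.elim f₁ f₂)).Injective then 1 else 0) *
      (coincidenceMatrix f₁ f₄).det ^ 2 * (coincidenceMatrix f₂ f₃).det ^ 2 := by
  rw [det_coincidenceMatrix_sumElim_same, det_coincidenceMatrix_sumElim_same]
  -- Each side vanishes unless these three conditions hold.
  by_cases H : (coincidenceMatrix f₁ f₄).det ≠ 0 ∧ (coincidenceMatrix f₂ f₃).det ≠ 0 ∧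
    (Sum.elim f₁ f₂).Injective
  · obtain ⟨h14, h23, h12⟩ := H
    have m23 := forall_ne_iff_of_det_coincidenceMatrix_ne_zero h23
    have i3 := injective_right_of_det_coincidenceMatrix_ne_zero h23
    have h12' := sumElim_injective_iff.1 h12
    have n12 := h12'.2.2
    have n13 : ∀ x y, f₁ x ≠ f₃ y := fun x => (m23 _).1 (n12 x)
    rw [det_coincidenceMatrix_sumElim_of_ne n13, det_coincidenceMatrix_sumElim_of_ne n12,
      det_coincidenceMatrix_comm f₃ f₂]
    have hd : (Sum.elim d (Sum.elim f₁ f₃)).Injective ↔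
        (Sum.elim d (Sum.elim f₁ f₂)).Injective := by
      simp only [sumElim_injective_iff, Sum.forall, Sum.elim_inl, Sum.elim_inr, forall_and, m23]
      simp [h12'.1, h12'.2.1, i3, n13]
    simp only [hd]
    ring
  · have hr : (if (Sum.elim c (Sum.elim f₁ f₂)).Injective then (1 : ℝ) else 0) *
        (if (Sum.elim d (Sum.elim f₁ f₂)).Injective then 1 else 0) *
        (coincidenceMatrix f₁ f₄).det ^ 2 * (coincidenceMatrix f₂ f₃).det ^ 2 = 0 := by
      by_contra h
      simp only [mul_eq_zero, pow_eq_zero_iff, ne_eq, OfNat.ofNat_ne_zero, not_false_eq_true,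
        not_or, ite_eq_right_iff, one_ne_zero, imp_false, not_not] at h
      exact H ⟨h.1.2, h.2, (sumElim_injective_iff.1 h.1.1.1).2.1⟩
    rw [hr]
    by_contra h
    simp only [mul_eq_zero, not_or] at h
    obtain ⟨⟨-, h1⟩, -, h2⟩ := h
    have i12 := injective_left_of_det_coincidenceMatrix_ne_zero h1
    have i13 := injective_left_of_det_coincidenceMatrix_ne_zero h2
    rw [det_coincidenceMatrix_sumElim_of_ne (sumElim_injective_iff.1 i13).2.2, mul_eq_zero, not_or] at h1
    exact H ⟨h1.1, h1.2, i12⟩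

variable [Fintype κ]

/-- Only rearrangements `v = u ∘ σ` contribute, and for them the determinant is `±1`. -/
theorem sum_det_coincidenceMatrix_sq {u : α → κ} (hu : u.Injective) :
    ∑ v : α → κ, (coincidenceMatrix u v).det ^ 2 = ((Fintype.card α)! : ℝ) := by
  have hinj : Function.Injective fun σ : Equiv.Perm α => u ∘ σ := by
    intro σ τ h
    ext a
    exact hu (congrFun h a)
  have hval (σ : Equiv.Perm α) : (coincidenceMatrix u (u ∘ σ)).det ^ 2 = 1 := by
    have : coincidenceMatrix u (u ∘ σ) = (1 : Matrix α α ℝ).submatrix id σ := by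
      rw [← coincidenceMatrix_self hu]; rfl
    rw [this, Matrix.det_permute']
    rcases Int.units_eq_one_or (Equiv.Perm.sign σ) with h | h <;> simp [h]
  have := Finset.sum_subset (Finset.subset_univ (Finset.univ.image fun σ : Equiv.Perm α => u ∘ σ))
    (f := fun v => (coincidenceMatrix u v).det ^ 2) ?_
  · rw [← this, Finset.sum_image fun σ _ τ _ h => hinj h]
    simp [hval, Fintype.card_perm]
  · intro v _ hv
    by_contra h
    have h : (coincidenceMatrix u v).det ≠ 0 := fun h0 => h (by simp [h0])
    choose s hs using exists_eq_of_det_coincidenceMatrix_ne_zero h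
    have hsi : s.Injective := fun a c e =>
      injective_right_of_det_coincidenceMatrix_ne_zero h (by rw [← hs, ← hs, e])
    refine hv (Finset.mem_image.2 ⟨Equiv.ofBijective s (Finite.injective_iff_bijective.1 hsi),
      Finset.mem_univ _, ?_⟩)
    ext a
    exact hs a

open Classical in
theorem sum_injective : ∑ u : α → κ, (if u.Injective then 1 else 0 : ℝ) =
    ((Fintype.card κ).descFactorial (Fintype.card α) : ℝ) := by
  rw [Finset.sum_boole, ← Fintype.card_embedding_eq, ← Fintype.card_subtype]
  exact congrArg _ (Fintype.card_congr (Equiv.subtypeInjectiveEquivEmbedding α κ))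

-- The maps counted are the embeddings of `α` into the complement of the range of `g`.
open Classical in
theorem sum_sumElim_injective {α β κ : Type*} [Fintype α] [DecidableEq α] [Fintype β] [Fintype κ]
    [DecidableEq κ] {g : β → κ} (hg : g.Injective) :
    ∑ u : α → κ, (if (Sum.elim u g).Injective then 1 else 0 : ℝ) =
      ((Fintype.card κ - Fintype.card β).descFactorial (Fintype.card α) : ℝ) := by
  have hc : Fintype.card {y // ∀ x, y ≠ g x} = Fintype.card κ - Fintype.card β := by
    rw [Fintype.card_subtype, ← Finset.card_univ (α := β),
      ← Finset.card_image_of_injective Finset.univ hg, ← Finset.card_univ_sdiff]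
    congr 1
    ext y
    simp [eq_comm]
  rw [← hc, Finset.sum_boole, ← Fintype.card_embedding_eq, ← Fintype.card_subtype]
  refine congrArg _ (Fintype.card_congr ?_)
  exact
    { toFun := fun u => ⟨fun a => ⟨u.1 a, (sumElim_injective_iff.1 u.2).2.2 a⟩,
        fun a c h => (sumElim_injective_iff.1 u.2).1 (congrArg Subtype.val h)⟩
      invFun := fun e => ⟨fun a => e a, sumElim_injective_iff.2
        ⟨fun a c h => e.injective (Subtype.ext h), hg, fun a => (e a).2⟩⟩
      left_inv := fun u => rfl
      right_inv := fun e => rfl }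

theorem sum_sum_arrow {α β κ : Type*} [Fintype α] [Fintype β] [Fintype κ] [DecidableEq α] [DecidableEq β]
    (F : (α ⊕ β → κ) → ℝ) :
    ∑ f, F f = ∑ a : α → κ, ∑ b : β → κ, F (Sum.elim a b) := by
  rw [← Fintype.sum_prod_type']
  exact Fintype.sum_equiv (Equiv.sumArrowEquivProdArrow α β κ) _ _ fun f => by
    congr 1; ext (x | x) <;> simp

/-- Here `g` carries `f₁` and `f₂` together: its injectivity gives the first factor, `c` and `d`
each avoid its range, and `f₄`, `f₃` rearrange `f₁`, `f₂`. -/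
theorem sum_det_coincidenceMatrix_mul_det {δ : Type*} [Fintype δ] [DecidableEq δ] :
    ∑ g : α ⊕ β → κ, ∑ f₃ : β → κ, ∑ f₄ : α → κ, ∑ c : δ → κ, ∑ d : δ → κ,
      (coincidenceMatrix (Sum.elim c g) (Sum.elim c (Sum.elim f₄ f₃))).det *
      (coincidenceMatrix (Sum.elim d (Sum.elim (g ∘ Sum.inl) f₃))
        (Sum.elim d (Sum.elim f₄ (g ∘ Sum.inr)))).det =
    ((Fintype.card κ).descFactorial (Fintype.card α + Fintype.card β) : ℝ) *
      ((Fintype.card κ - (Fintype.card α + Fintype.card β)).descFactorial (Fintype.card δ) : ℝ) ^ 2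
      * ((Fintype.card α)! : ℝ) * ((Fintype.card β)! : ℝ) := by
  classical
  have inner (g : α ⊕ β → κ) : ∑ f₃ : β → κ, ∑ f₄ : α → κ, ∑ c : δ → κ, ∑ d : δ → κ,
      (coincidenceMatrix (Sum.elim c g) (Sum.elim c (Sum.elim f₄ f₃))).det *
      (coincidenceMatrix (Sum.elim d (Sum.elim (g ∘ Sum.inl) f₃))
        (Sum.elim d (Sum.elim f₄ (g ∘ Sum.inr)))).det = (if g.Injective then 1 else 0) *
      (((Fintype.card κ - (Fintype.card α + Fintype.card β)).descFactorial
        (Fintype.card δ) : ℝ) ^ 2 * ((Fintype.card α)! : ℝ) * ((Fintype.card β)! : ℝ)) := by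
    obtain ⟨f₁, f₂, rfl⟩ : ∃ f₁ f₂, g = Sum.elim f₁ f₂ :=
      ⟨g ∘ Sum.inl, g ∘ Sum.inr, (Sum.elim_comp_inl_inr g).symm⟩
    simp only [Sum.elim_comp_inl, Sum.elim_comp_inr, det_coincidenceMatrix_mul_det]
    split_ifs with hg
    · have h' := sumElim_injective_iff.1 hg
      simp_rw [← Finset.sum_mul, ← Finset.mul_sum, ← Finset.sum_mul,
        sum_sumElim_injective hg, sum_det_coincidenceMatrix_sq h'.1,
        sum_det_coincidenceMatrix_sq h'.2.1, Fintype.card_sum]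
      ring
    · rw [zero_mul]
      refine Finset.sum_eq_zero fun f₃ _ => Finset.sum_eq_zero fun f₄ _ =>
        Finset.sum_eq_zero fun c _ => Finset.sum_eq_zero fun d _ => ?_
      rw [if_neg fun h => hg (sumElim_injective_iff.1 h).2.1]
      simp
  simp_rw [inner, ← Finset.sum_mul, sum_injective, Fintype.card_sum]
  ring

end Coincidence

/-! ### The block form of the expectation -/

section Blocks

variable {E : Type*} [NormedAddCommGroup E] [InnerProductSpace ℝ E]

theorem gram_orthonormalBasis_comp_submatrix {κ γ α β : Type*} [Fintype κ] [DecidableEq κ]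
    (b : OrthonormalBasis κ ℝ E) (f : γ → κ) (u : α → γ) (v : β → γ) :
    (Matrix.gram ℝ (b ∘ f)).submatrix u v = coincidenceMatrix (f ∘ u) (f ∘ v) := by
  ext a c
  simp [Matrix.gram_apply, coincidenceMatrix, b.inner_eq_ite]

variable [FiniteDimensional ℝ E] [MeasurableSpace E] [BorelSpace E]

open Sum in
/-- Two minors of a standard Gaussian Gram matrix that together involve every vector exactly
twice. The summands of the index type stand for `(I \ J) ∩ (K \ L)`, `(I \ J) ∩ (L \ K)`,
`(J \ I) ∩ (K \ L)`, `(J \ I) ∩ (L \ K)`, `I ∩ J` and `K ∩ L`, where `I ∩ J ∩ K ∩ L = ∅`. -/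
theorem integral_det_gram_mul_det_gram (P Q D : Type*) [Fintype P] [DecidableEq P] [Fintype Q]
    [DecidableEq Q] [Fintype D] [DecidableEq D] :
    ∫ h : (P ⊕ Q) ⊕ ((Q ⊕ P) ⊕ (D ⊕ D)) → E,
      ((Matrix.gram ℝ h).submatrix (Sum.elim (fun x : D => inr (inr (inl x))) inl)
        (Sum.elim (fun x : D => inr (inr (inl x)))
          (Sum.elim (fun x => inr (inl (inr x))) fun x => inr (inl (inl x))))).det *
      ((Matrix.gram ℝ h).submatrix
        (Sum.elim (fun x : D => inr (inr (inr x)))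
          (Sum.elim (fun x => inl (inl x)) fun x => inr (inl (inl x))))
        (Sum.elim (fun x : D => inr (inr (inr x)))
          (Sum.elim (fun x => inr (inl (inr x))) fun x => inl (inr x)))).det
      ∂(Measure.pi fun _ => stdGaussian E) =
    ((Module.finrank ℝ E).descFactorial (Fintype.card P + Fintype.card Q) : ℝ) *
      ((Module.finrank ℝ E - (Fintype.card P + Fintype.card Q)).descFactorial
        (Fintype.card D) : ℝ) ^ 2 * ((Fintype.card P)! : ℝ) * ((Fintype.card Q)! : ℝ) := by
  rw [integral_pi_stdGaussian (stdOrthonormalBasis ℝ E) _ (integrable_det_mul_det_gram _ _ _ _)]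
  · simp_rw [gram_orthonormalBasis_comp_submatrix]
    rw [sum_sum_arrow]
    simp_rw [sum_sum_arrow (α := Q ⊕ P), sum_sum_arrow (α := Q) (β := P),
      sum_sum_arrow (α := D) (β := D)]
    have := sum_det_coincidenceMatrix_mul_det (α := P) (β := Q) (δ := D)
      (κ := Fin (Module.finrank ℝ E))
    rw [Fintype.card_fin] at this
    rw [← this]
    refine Finset.sum_congr rfl fun g _ => Finset.sum_congr rfl fun f₃ _ =>
      Finset.sum_congr rfl fun f₄ _ => Finset.sum_congr rfl fun c _ =>
      Finset.sum_congr rfl fun d _ => ?_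
    congr 3 <;> ext x <;> rcases x with x | x | x <;> rfl
  · intro g x
    have h := Submodule.mul_mem_mul
      (det_gram_update_mem_innerFunctionals_pow
        (Sum.elim (fun x : D => inr (inr (inl x))) inl) (Sum.elim (fun x : D => inr (inr (inl x)))
          (Sum.elim (fun x => inr (inl (inr x))) fun x => inr (inl (inl x)))) g x)
      (det_gram_update_mem_innerFunctionals_pow
        (Sum.elim (fun x : D => inr (inr (inr x)))
          (Sum.elim (fun x => inl (inl x)) fun x => inr (inl (inl x))))
        (Sum.elim (fun x : D => inr (inr (inr x)))
          (Sum.elim (fun x => inr (inl (inr x))) fun x => inl (inr x))) g x)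
    rw [← pow_add] at h
    -- Each of the first four blocks labels one side of each minor, while each copy of `D` labels
    -- both a row and a column of a single minor.
    have hdeg : ((∑ a, if (Sum.elim (fun x : D => inr (inr (inl x))) inl) a = x then 1 else 0) +
        ∑ a, if (Sum.elim (fun x : D => inr (inr (inl x)))
          (Sum.elim (fun x => inr (inl (inr x))) fun x => inr (inl (inl x)))) a = x then 1 else 0) +
        ((∑ a, if (Sum.elim (fun x : D => inr (inr (inr x)))
          (Sum.elim (fun x => inl (inl x)) fun x => inr (inl (inl x)))) a = x then 1 else 0) +
        ∑ a, if (Sum.elim (fun x : D => inr (inr (inr x)))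
          (Sum.elim (fun x => inr (inl (inr x))) fun x => inl (inr x))) a = x then 1 else 0) =
        2 := by
      rcases x with (x | x) | (x | x) | (x | x) <;>
        simp only [Fintype.sum_sum_type, Sum.elim_inl, Sum.elim_inr, inl.injEq, inr.injEq,
          reduceCtorEq, if_false, Finset.sum_const_zero, Finset.sum_ite_eq', Finset.mem_univ,
          if_true, zero_add, add_zero, Nat.reduceAdd]
    rw [hdeg] at h
    exact h

end Blocks

/-! ### Sorted index sets and signs of rearrangements -/

section Sorting

/-- Relabelling multiplies a determinant by the sign of the permutation between row and column
labelling; when the two minors share this permutation, the signs square to 1. -/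
theorem det_submatrix_mul_det_submatrix {R α β : Type*} [CommRing R] [Fintype α] [DecidableEq α]
    [Fintype β] [DecidableEq β] (M N : Matrix β β R) {e₁ e₂ e₁' e₂' : α ≃ β}
    (h : e₁.trans e₂.symm = e₁'.trans e₂'.symm) :
    (M.submatrix e₁ e₂).det * (N.submatrix e₁' e₂').det = M.det * N.det := by
  have key (M : Matrix β β R) (e₁ e₂ : α ≃ β) : (M.submatrix e₁ e₂).det =
      Equiv.Perm.sign (e₁.trans e₂.symm : Equiv.Perm α) * M.det := by
    have : M.submatrix e₁ e₂ = (M.submatrix e₂ e₂).submatrix (e₁.trans e₂.symm) id := by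
      ext; simp
    rw [this, Matrix.det_permute, Matrix.det_submatrix_equiv_self]
  rw [key, key, h]
  rcases Int.units_eq_one_or (Equiv.Perm.sign (e₁'.trans e₂'.symm : Equiv.Perm α)) with h | h <;>
    simp [h]

/-- Concatenating the two sorted lists is strictly increasing, and the increasing enumeration is
unique. -/
theorem orderEmbOfFin_union {ι : Type*} [LinearOrder ι] {S T U : Finset ι} (hU : U = S ∪ T)
    (hlt : SetLT S T) {s t u : ℕ} (hS : S.card = s) (hT : T.card = t) (hUc : U.card = u)
    (h : s + t = u) (x : Fin s ⊕ Fin t) :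
    U.orderEmbOfFin hUc (finCongr h (finSumFinEquiv x)) =
      Sum.elim (S.orderEmbOfFin hS) (T.orderEmbOfFin hT) x := by
  subst h
  have := Finset.orderEmbOfFin_unique hUc
    (f := fun i => Sum.elim (S.orderEmbOfFin hS) (T.orderEmbOfFin hT) (finSumFinEquiv.symm i)) ?_ ?_
  · have := congrFun this (finSumFinEquiv x)
    simpa using this.symm
  · intro i
    rw [hU]
    rcases finSumFinEquiv.symm i with j | j <;> simp
  · intro i j hij
    obtain ⟨i, rfl⟩ := finSumFinEquiv.surjective i
    obtain ⟨j, rfl⟩ := finSumFinEquiv.surjective j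
    simp only [Equiv.symm_apply_apply]
    rcases i with i | i <;> rcases j with j | j
    · exact (S.orderEmbOfFin hS).strictMono (by
        simpa only [Fin.lt_def, finSumFinEquiv_apply_left, Fin.val_castAdd] using hij)
    · exact hlt _ (by simp) _ (by simp)
    · exfalso
      simp only [Fin.lt_def, finSumFinEquiv_apply_left, finSumFinEquiv_apply_right,
        Fin.val_castAdd, Fin.val_natAdd] at hij
      omega
    · exact (T.orderEmbOfFin hT).strictMono (by
        simpa only [Fin.lt_def, finSumFinEquiv_apply_right, Fin.val_natAdd,
          add_lt_add_iff_left] using hij)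

end Sorting

/-! ### No index common to all four sets -/

section Disjoint

variable {ι : Type*} [Fintype ι] [LinearOrder ι]
  {E : Type*} [NormedAddCommGroup E] [InnerProductSpace ℝ E] [FiniteDimensional ℝ E]
  [MeasurableSpace E] [BorelSpace E]

open Sum in
theorem integral_minor_gram_mul_minor_gram_of_blocks {B C P₁ P₂ P₃ P₄ I J K L : Finset ι}
    {b p q m : ℕ} (hB : B.card = b) (hC : C.card = b) (h₁ : P₁.card = p) (h₂ : P₂.card = q)
    (h₃ : P₃.card = q) (h₄ : P₄.card = p) (hm : b + (p + q) = m)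
    (hdisj : [P₁, P₂, P₃, P₄, B, C].Pairwise Disjoint)
    (eI : I = B ∪ (P₁ ∪ P₂)) (eJ : J = B ∪ (P₃ ∪ P₄)) (eK : K = (P₁ ∪ P₃) ∪ C)
    (eL : L = (P₂ ∪ P₄) ∪ C)
    (oI : SetLT B (P₁ ∪ P₂)) (oJ : SetLT B (P₃ ∪ P₄)) (oK : SetLT (P₁ ∪ P₃) C)
    (oL : SetLT (P₂ ∪ P₄) C) (o₁₂ : SetLT P₁ P₂) (o₃₄ : SetLT P₃ P₄) (o₁₃ : SetLT P₁ P₃)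
    (o₂₄ : SetLT P₂ P₄)
    (hI : I.card = m) (hJ : J.card = m) (hK : K.card = m) (hL : L.card = m) :
    ∫ g : ι → E, minor (Matrix.gram ℝ g) I J hI hJ * minor (Matrix.gram ℝ g) K L hK hL
      ∂(Measure.pi fun _ => stdGaussian E) =
    ((Module.finrank ℝ E).descFactorial (p + q) : ℝ) *
      ((Module.finrank ℝ E - (p + q)).descFactorial b : ℝ) ^ 2 * (p ! : ℝ) * (q ! : ℝ) := by
  simp only [List.pairwise_cons, List.mem_cons, List.not_mem_nil, or_false, forall_eq_or_imp,
    forall_eq, List.Pairwise.nil, and_true] at hdisj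
  obtain ⟨⟨d12, d13, d14, d1B, d1C⟩, ⟨d23, d24, d2B, d2C⟩, ⟨d34, d3B, d3C⟩, ⟨d4B, d4C⟩, dBC, -⟩ :=
    hdisj
  let ρ : (Fin p ⊕ Fin q) ⊕ ((Fin q ⊕ Fin p) ⊕ (Fin b ⊕ Fin b)) → ι :=
    Sum.elim (Sum.elim (P₁.orderEmbOfFin h₁) (P₂.orderEmbOfFin h₂))
      (Sum.elim (Sum.elim (P₃.orderEmbOfFin h₃) (P₄.orderEmbOfFin h₄))
        (Sum.elim (B.orderEmbOfFin hB) (C.orderEmbOfFin hC)))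
  have hne {S T : Finset ι} {s t : ℕ} (hS : S.card = s) (hT : T.card = t) (h : Disjoint S T)
      (x : Fin s) (y : Fin t) : S.orderEmbOfFin hS x ≠ T.orderEmbOfFin hT y :=
    h.forall_ne_finset (Finset.orderEmbOfFin_mem _ _ _) (Finset.orderEmbOfFin_mem _ _ _)
  have hρ : ρ.Injective := by
    simp only [ρ, sumElim_injective_iff, Sum.forall, Sum.elim_inl, Sum.elim_inr,
      RelEmbedding.injective, true_and]
    refine ⟨hne _ _ d12, ⟨hne _ _ d34, hne _ _ dBC, ?_⟩, ?_⟩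
    · exact ⟨fun x => ⟨hne _ _ d3B x, hne _ _ d3C x⟩, fun x => ⟨hne _ _ d4B x, hne _ _ d4C x⟩⟩
    · exact ⟨fun x => ⟨⟨hne _ _ d13 x, hne _ _ d14 x⟩, ⟨hne _ _ d1B x, hne _ _ d1C x⟩⟩,
        fun x => ⟨⟨hne _ _ d23 x, hne _ _ d24 x⟩, ⟨hne _ _ d2B x, hne _ _ d2C x⟩⟩⟩
  let η : Fin p ⊕ Fin q ≃ Fin (p + q) := finSumFinEquiv
  -- The sorted columns list the block of size `q` first (`P₃` before `P₄`, `P₂` before `P₄`); the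
  -- swap aligns `P₄` with `P₁`, and the `q`-block with the other `q`-block.
  let η' : Fin p ⊕ Fin q ≃ Fin (p + q) :=
    ((Equiv.sumComm _ _).trans finSumFinEquiv).trans (finCongr (add_comm q p))
  let ψ : Fin b ⊕ Fin (p + q) ≃ Fin m := finSumFinEquiv.trans (finCongr hm)
  -- `C` comes last in `K` and `L`, whereas `B` comes first in `I` and `J`.
  let ψ' : Fin b ⊕ Fin (p + q) ≃ Fin m :=
    ((Equiv.sumComm _ _).trans finSumFinEquiv).trans (finCongr ((add_comm _ _).trans hm))
  have c12 : (P₁ ∪ P₂).card = p + q := by rw [Finset.card_union_of_disjoint d12, h₁, h₂]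
  have c34 : (P₃ ∪ P₄).card = p + q := by rw [Finset.card_union_of_disjoint d34, h₃, h₄, add_comm]
  have c13 : (P₁ ∪ P₃).card = p + q := by rw [Finset.card_union_of_disjoint d13, h₁, h₃]
  have c24 : (P₂ ∪ P₄).card = p + q := by rw [Finset.card_union_of_disjoint d24, h₂, h₄, add_comm]
  have fI (x) : I.orderEmbOfFin hI ((Equiv.sumCongr (Equiv.refl _) η).trans ψ x) =
      ρ (Sum.elim (fun x : Fin b => inr (inr (inl x))) inl x) := by
    refine (orderEmbOfFin_union eI oI hB c12 hI hm (Sum.map id η x)).trans ?_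
    rcases x with x | x
    · rfl
    · refine (orderEmbOfFin_union rfl o₁₂ h₁ h₂ c12 rfl x).trans ?_
      rcases x with x | x <;> rfl
  have fJ (x) : J.orderEmbOfFin hJ ((Equiv.sumCongr (Equiv.refl _) η').trans ψ x) =
      ρ (Sum.elim (fun x : Fin b => inr (inr (inl x)))
          (Sum.elim (fun x => inr (inl (inr x))) fun x => inr (inl (inl x))) x) := by
    refine (orderEmbOfFin_union eJ oJ hB c34 hJ hm (Sum.map id η' x)).trans ?_
    rcases x with x | x
    · rfl
    · refine (orderEmbOfFin_union rfl o₃₄ h₃ h₄ c34 (add_comm q p) x.swap).trans ?_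
      rcases x with x | x <;> rfl
  have fK (x) : K.orderEmbOfFin hK ((Equiv.sumCongr (Equiv.refl _) η).trans ψ' x) =
      ρ (Sum.elim (fun x : Fin b => inr (inr (inr x)))
          (Sum.elim (fun x => inl (inl x)) fun x => inr (inl (inl x))) x) := by
    refine (orderEmbOfFin_union eK oK c13 hC hK ((add_comm _ _).trans hm)
      (Sum.map id η x).swap).trans ?_
    rcases x with x | x
    · rfl
    · refine (orderEmbOfFin_union rfl o₁₃ h₁ h₃ c13 rfl x).trans ?_
      rcases x with x | x <;> rfl
  have fL (x) : L.orderEmbOfFin hL ((Equiv.sumCongr (Equiv.refl _) η').trans ψ' x) =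
      ρ (Sum.elim (fun x : Fin b => inr (inr (inr x)))
          (Sum.elim (fun x => inr (inl (inr x))) fun x => inl (inr x)) x) := by
    refine (orderEmbOfFin_union eL oL c24 hC hL ((add_comm _ _).trans hm)
      (Sum.map id η' x).swap).trans ?_
    rcases x with x | x
    · rfl
    · refine (orderEmbOfFin_union rfl o₂₄ h₂ h₄ c24 (add_comm q p) x.swap).trans ?_
      rcases x with x | x <;> rfl
  have key := integral_det_gram_mul_det_gram (E := E) (Fin p) (Fin q) (Fin b)
  simp only [Fintype.card_fin] at key
  have hmp := measurePreserving_pi_comp (stdGaussian E) hρ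
  rw [← key, ← hmp.map_eq, integral_map hmp.measurable.aemeasurable
    (by rw [hmp.map_eq]; exact (integrable_det_mul_det_gram _ _ _ _).aestronglyMeasurable)]
  refine integral_congr_ae (ae_of_all _ fun g => ?_)
  simp only [minor]
  -- `ψ` and `ψ'` act on rows and columns alike and cancel; both minors are left with the
  -- permutation from `η` to `η'`.
  rw [← det_submatrix_mul_det_submatrix _ _
    (e₁ := (Equiv.sumCongr (Equiv.refl _) η).trans ψ)
    (e₂ := (Equiv.sumCongr (Equiv.refl _) η').trans ψ)
    (e₁' := (Equiv.sumCongr (Equiv.refl _) η).trans ψ')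
    (e₂' := (Equiv.sumCongr (Equiv.refl _) η').trans ψ') (by ext x; simp)]
  congr 2
  · ext x y
    simp only [Matrix.submatrix_apply, Matrix.gram_apply, fI, fJ]
  · ext x y
    simp only [Matrix.submatrix_apply, Matrix.gram_apply, fK, fL]

/-- The factor with `n + 2 - 0` is 1, inserted to match the general formula at intersection size 0.
-/
theorem descFactorial_mul_sq_eq {n m b p q : ℕ} (hm : b + (p + q) = m) (hmn : m ≤ n) :
    (n.descFactorial (p + q) : ℝ) * ((n - (p + q)).descFactorial b : ℝ) ^ 2 * (p ! : ℝ) * (q ! : ℝ) =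
    (n ! : ℝ) / ((n - m)! : ℝ) * (((n + 2)! : ℝ) / ((n + 2 - 0)! : ℝ))
      * (((n - m + b)! : ℝ) / ((n - m)! : ℝ)) * (p ! : ℝ) * (q ! : ℝ) := by
  have e1 : ((n - (p + q))! : ℝ) * n.descFactorial (p + q) = n ! := by
    exact_mod_cast Nat.factorial_mul_descFactorial (by omega)
  have e2 : ((n - m)! : ℝ) * (n - (p + q)).descFactorial b = (n - (p + q))! := by
    have := Nat.factorial_mul_descFactorial (n := n - (p + q)) (k := b) (by omega)
    rw [show n - (p + q) - b = n - m by omega] at this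
    exact_mod_cast this
  rw [show n - m + b = n - (p + q) by omega, Nat.sub_zero,
    div_self (by positivity : ((n + 2)! : ℝ) ≠ 0), ← e1, ← e2]
  have : ((n - m)! : ℝ) ≠ 0 := by positivity
  field_simp

end Disjoint

/-- Recursion of the closed formula when a common index is removed: the ratio is `𝔼‖v‖⁴` in
dimension `n + 1`. -/
theorem factorial_ratio_succ {n k a b : ℕ} (hk : k ≤ n) (ha : a ≤ n + 2) :
    ((n + 1)! : ℝ) / ((n + 1 - (k + 1))! : ℝ)
      * (((n + 1 + 2)! : ℝ) / ((n + 1 + 2 - (a + 1))! : ℝ))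
      * (((n + 1 - (k + 1) + b)! : ℝ) / ((n + 1 - (k + 1))! : ℝ)) =
    ((n + 1 : ℝ) * (n + 1 + 2)) * ((n ! : ℝ) / ((n - k)! : ℝ)
      * (((n + 2)! : ℝ) / ((n + 2 - a)! : ℝ)) * (((n - k + b)! : ℝ) / ((n - k)! : ℝ))) := by
  rw [show n + 1 - (k + 1) = n - k by omega, show n + 1 + 2 - (a + 1) = n + 2 - a by omega,
    show n + 1 + 2 = (n + 2) + 1 by omega, Nat.factorial_succ n, Nat.factorial_succ (n + 2)]
  push_cast
  ring

/-! ### Conditioning on one vector -/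

section Step

/-- This identifies the Schur complement of a Gram matrix with the Gram matrix of projections to
`vᗮ`. -/
theorem gram_orthogonalProjectionOnto {E ι : Type*} [NormedAddCommGroup E] [InnerProductSpace ℝ E]
    [FiniteDimensional ℝ E] {v : E} (g : ι → E) (i j : ι) :
    Matrix.gram ℝ (fun i => (ℝ ∙ v)ᗮ.orthogonalProjectionOnto (g i)) i j =
      inner ℝ (g i) (g j) - inner ℝ (g i) v * inner ℝ v (g j) / inner ℝ v v := by
  rw [Matrix.gram_apply, Submodule.inner_orthogonalProjectionOnto_eq_of_mem_right]
  have : ((ℝ ∙ v)ᗮ.orthogonalProjectionOnto (g j) : E) =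
      g j - (inner ℝ v (g j) / ‖v‖ ^ 2) • v := by
    rw [Submodule.coe_orthogonalProjectionOnto_apply, Submodule.starProjection_orthogonal_val,
      Submodule.starProjection_singleton]
    simp
  rw [this, inner_sub_right, inner_smul_right, real_inner_self_eq_norm_sq]
  ring

theorem measurePreserving_pi_orthogonalProjectionOnto {E ι : Type*} [Fintype ι]
    [NormedAddCommGroup E] [InnerProductSpace ℝ E] [FiniteDimensional ℝ E] [MeasurableSpace E]
    [BorelSpace E] (U : Submodule ℝ E) :
    MeasurePreserving (fun (g : ι → E) i => U.orthogonalProjectionOnto (g i))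
      (Measure.pi fun _ => stdGaussian E) (Measure.pi fun _ => stdGaussian U) := by
  have hm : Measurable U.orthogonalProjectionOnto := by fun_prop
  refine ⟨by fun_prop, ?_⟩
  have hp : IsProbabilityMeasure ((stdGaussian E).map U.orthogonalProjectionOnto) :=
    Measure.isProbabilityMeasure_map hm.aemeasurable
  rw [Measure.pi_map_pi fun _ => hm.aemeasurable]
  simp_rw [stdGaussian_map_orthogonalProjectionOnto]

variable {ι : Type*} [LinearOrder ι]
  {E : Type*} [NormedAddCommGroup E] [InnerProductSpace ℝ E] [FiniteDimensional ℝ E]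

theorem minor_gram_mul_minor_gram_update {I J K L : Finset ι} {k : ℕ} (hI : I.card = k + 1)
    (hJ : J.card = k + 1) (hK : K.card = k + 1) (hL : L.card = k + 1) (h : I ∆ J = K ∆ L)
    {x : ι} (xI : x ∈ I) (xJ : x ∈ J) (xK : x ∈ K) (xL : x ∈ L)
    (hI' : (I.erase x).card = k) (hJ' : (J.erase x).card = k) (hK' : (K.erase x).card = k)
    (hL' : (L.erase x).card = k) (v : E) (g : ι → E) :
    minor (Matrix.gram ℝ (Function.update g x v)) I J hI hJ *
      minor (Matrix.gram ℝ (Function.update g x v)) K L hK hL =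
    ‖v‖ ^ 4 *
      (minor (Matrix.gram ℝ fun i => (ℝ ∙ v)ᗮ.orthogonalProjectionOnto (g i))
        (I.erase x) (J.erase x) hI' hJ' *
      minor (Matrix.gram ℝ fun i => (ℝ ∙ v)ᗮ.orthogonalProjectionOnto (g i))
        (K.erase x) (L.erase x) hK' hL') := by
  by_cases hv : v = 0
  -- Both sides vanish at `v = 0`, where no Schur complement exists.
  · subst hv
    rw [minor_eq_zero_of_row (x := x) (by simp [Matrix.gram_apply]) hI hJ xI]
    simp
  · have hxx : Matrix.gram ℝ (Function.update g x v) x x ≠ 0 := by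
      simpa [Matrix.gram_apply] using hv
    have hM (i j : ι) (hi : i ≠ x) (hj : j ≠ x) :
        Matrix.gram ℝ (fun i => (ℝ ∙ v)ᗮ.orthogonalProjectionOnto (g i)) i j =
        Matrix.gram ℝ (Function.update g x v) i j - Matrix.gram ℝ (Function.update g x v) i x *
          Matrix.gram ℝ (Function.update g x v) x j / Matrix.gram ℝ (Function.update g x v) x x := by
      rw [gram_orthogonalProjectionOnto]
      simp [Matrix.gram_apply, hi, hj]
    rw [minor_eq_mul_minor_schur hxx hM hI hJ xI xJ hI' hJ',
      minor_eq_mul_minor_schur hxx hM hK hL xK xL hK' hL']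
    have hs := (even_card_filter_of_symmDiff_eq h (· < x)).neg_one_pow (α := ℝ)
    rw [pow_add] at hs
    have hn : Matrix.gram ℝ (Function.update g x v) x x = ‖v‖ ^ 2 := by
      simp [Matrix.gram_apply]
    rw [hn]
    linear_combination ‖v‖ ^ 4 *
      (minor (Matrix.gram ℝ fun i => (ℝ ∙ v)ᗮ.orthogonalProjectionOnto (g i))
        (I.erase x) (J.erase x) hI' hJ' *
      minor (Matrix.gram ℝ fun i => (ℝ ∙ v)ᗮ.orthogonalProjectionOnto (g i))
        (K.erase x) (L.erase x) hK' hL') * hs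

variable [Fintype ι] [MeasurableSpace E] [BorelSpace E]

/-- Conditioning on a vector whose index lies in all four index sets. -/
theorem integral_minor_gram_mul_minor_gram_erase {I J K L : Finset ι} {k : ℕ}
    (hI : I.card = k + 1)
    (hJ : J.card = k + 1) (hK : K.card = k + 1) (hL : L.card = k + 1) (h : I ∆ J = K ∆ L)
    {x : ι} (xI : x ∈ I) (xJ : x ∈ J) (xK : x ∈ K) (xL : x ∈ L)
    (hI' : (I.erase x).card = k) (hJ' : (J.erase x).card = k) (hK' : (K.erase x).card = k)
    (hL' : (L.erase x).card = k) {c : ℝ}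
    (hc : ∀ v : E, v ≠ 0 → ∫ g : ι → (ℝ ∙ v)ᗮ,
      minor (Matrix.gram ℝ g) (I.erase x) (J.erase x) hI' hJ' *
      minor (Matrix.gram ℝ g) (K.erase x) (L.erase x) hK' hL'
      ∂(Measure.pi fun _ => stdGaussian (ℝ ∙ v)ᗮ) = c) :
    ∫ g : ι → E, minor (Matrix.gram ℝ g) I J hI hJ * minor (Matrix.gram ℝ g) K L hK hL
      ∂(Measure.pi fun _ => stdGaussian E) =
    (Module.finrank ℝ E : ℝ) * (Module.finrank ℝ E + 2) * c := by
  have hmp := measurePreserving_pi_update (stdGaussian E) x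
  have hint : Integrable (fun g : ι → E => minor (Matrix.gram ℝ g) I J hI hJ *
      minor (Matrix.gram ℝ g) K L hK hL) (Measure.pi fun _ => stdGaussian E) :=
    integrable_det_mul_det_gram _ _ _ _
  have hint' : Integrable (fun p : E × (ι → E) =>
      minor (Matrix.gram ℝ (Function.update p.2 x p.1)) I J hI hJ *
      minor (Matrix.gram ℝ (Function.update p.2 x p.1)) K L hK hL)
      ((stdGaussian E).prod (Measure.pi fun _ => stdGaussian E)) :=
    hmp.integrable_comp_of_integrable hint
  rw [← hmp.map_eq, integral_map hmp.measurable.aemeasurable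
    (by rw [hmp.map_eq]; exact hint.aestronglyMeasurable),
    integral_prod _ hint', ← integral_norm_pow_four_stdGaussian,
    ← integral_mul_const]
  refine integral_congr_ae (ae_of_all _ fun v => ?_)
  simp only [minor_gram_mul_minor_gram_update hI hJ hK hL h xI xJ xK xL hI' hJ' hK' hL' v,
    integral_const_mul]
  -- The factor `‖v‖ ^ 4` disposes of `v = 0`, the one case in which `vᗮ` need not have smaller
  -- dimension.
  by_cases hv : v = 0
  · simp [hv]
  · congr 1
    have hmp' := measurePreserving_pi_orthogonalProjectionOnto (ι := ι) (ℝ ∙ v)ᗮ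
    rw [← hc v hv, ← hmp'.map_eq, integral_map hmp'.measurable.aemeasurable
      (by rw [hmp'.map_eq]; exact (integrable_det_mul_det_gram _ _ _ _).aestronglyMeasurable)]

end Step

/-! ### Splitting the four sets into six disjoint blocks -/

section Decomposition

variable {ι : Type*} [LinearOrder ι]

theorem eq_union_of_symmDiff_eq {I J K L : Finset ι} (h : I ∆ J = K ∆ L)
    (hA : I ∩ J ∩ K ∩ L = ∅) :
    I \ (I ∩ J) = I \ (I ∩ J) ∩ (K \ (K ∩ L)) ∪ I \ (I ∩ J) ∩ (L \ (K ∩ L)) ∧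
    J \ (I ∩ J) = J \ (I ∩ J) ∩ (K \ (K ∩ L)) ∪ J \ (I ∩ J) ∩ (L \ (K ∩ L)) ∧
    I = (I ∩ J) \ (K ∩ L) ∪
      (I \ (I ∩ J) ∩ (K \ (K ∩ L)) ∪ I \ (I ∩ J) ∩ (L \ (K ∩ L))) ∧
    J = (I ∩ J) \ (K ∩ L) ∪
      (J \ (I ∩ J) ∩ (K \ (K ∩ L)) ∪ J \ (I ∩ J) ∩ (L \ (K ∩ L))) ∧
    K = (I \ (I ∩ J) ∩ (K \ (K ∩ L)) ∪ J \ (I ∩ J) ∩ (K \ (K ∩ L))) ∪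
      (K ∩ L) \ (I ∩ J) ∧
    L = (I \ (I ∩ J) ∩ (L \ (K ∩ L)) ∪ J \ (I ∩ J) ∩ (L \ (K ∩ L))) ∪
      (K ∩ L) \ (I ∩ J) := by
  have hsd (y : ι) := congrArg (y ∈ ·) h
  have hA' (y : ι) := congrArg (y ∈ ·) hA
  simp only [Finset.mem_symmDiff, Finset.mem_inter, Finset.notMem_empty, eq_iff_iff,
    iff_false] at hsd hA'
  clear h hA
  refine ⟨?_, ?_, ?_, ?_, ?_, ?_⟩ <;> ext y <;> have h1 := hsd y <;> have h2 := hA' y <;>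
    clear hsd hA' <;> simp only [Finset.mem_union, Finset.mem_inter, Finset.mem_sdiff] <;> grind

theorem pairwise_disjoint_of_sdiff_inter (I J K L : Finset ι) :
    [I \ (I ∩ J) ∩ (K \ (K ∩ L)), I \ (I ∩ J) ∩ (L \ (K ∩ L)),
      J \ (I ∩ J) ∩ (K \ (K ∩ L)), J \ (I ∩ J) ∩ (L \ (K ∩ L)),
      (I ∩ J) \ (K ∩ L), (K ∩ L) \ (I ∩ J)].Pairwise Disjoint := by
  simp only [List.pairwise_cons, List.mem_cons, List.not_mem_nil, or_false, forall_eq_or_imp,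
    forall_eq, List.Pairwise.nil, and_true]
  simp only [Finset.disjoint_left, Finset.mem_inter, Finset.mem_sdiff]
  refine ⟨⟨?_, ?_, ?_, ?_, ?_⟩, ⟨?_, ?_, ?_, ?_⟩, ⟨?_, ?_, ?_⟩, ⟨?_, ?_⟩, ?_, ?_⟩ <;> grind

end Decomposition

theorem integral_minor_gram_mul_minor_gram_of_inter_eq_empty {ι : Type*} [Fintype ι]
    [LinearOrder ι] {E : Type*} [NormedAddCommGroup E] [InnerProductSpace ℝ E]
    [FiniteDimensional ℝ E] [MeasurableSpace E] [BorelSpace E] {m : ℕ}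
    (hmn : m ≤ Module.finrank ℝ E) {I J K L : Finset ι}
    (hI : I.card = m) (hJ : J.card = m) (hK : K.card = m) (hL : L.card = m)
    (hIJKL : I ∆ J = K ∆ L) (hA : I ∩ J ∩ K ∩ L = ∅)
    (h₁ : SetLT ((I ∩ J) \ (K ∩ L)) (I \ (I ∩ J))) (h₂ : SetLT (I \ (I ∩ J)) (J \ (I ∩ J)))
    (h₃ : SetLT (J \ (I ∩ J)) ((K ∩ L) \ (I ∩ J)))
    (h₄ : SetLT (I \ (I ∩ J) ∩ (K \ (K ∩ L))) (I \ (I ∩ J) ∩ (L \ (K ∩ L))))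
    (h₅ : SetLT (J \ (I ∩ J) ∩ (K \ (K ∩ L))) (J \ (I ∩ J) ∩ (L \ (K ∩ L)))) :
    ∫ g : ι → E, minor (Matrix.gram ℝ g) I J hI hJ * minor (Matrix.gram ℝ g) K L hK hL
      ∂(Measure.pi fun _ => stdGaussian E) =
    ((Module.finrank ℝ E)! : ℝ) / ((Module.finrank ℝ E - m)! : ℝ)
      * (((Module.finrank ℝ E + 2)! : ℝ) / ((Module.finrank ℝ E + 2 - 0)! : ℝ))
      * (((Module.finrank ℝ E - m + ((I ∩ J) \ (K ∩ L)).card)! : ℝ) /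
          ((Module.finrank ℝ E - m)! : ℝ))
      * ((I \ (I ∩ J) ∩ (K \ (K ∩ L))).card ! : ℝ)
      * ((I \ (I ∩ J) ∩ (L \ (K ∩ L))).card ! : ℝ) := by
  obtain ⟨eI', eJ', eI, eJ, eK, eL⟩ := eq_union_of_symmDiff_eq hIJKL hA
  have hdisj := pairwise_disjoint_of_sdiff_inter I J K L
  generalize hB : (I ∩ J) \ (K ∩ L) = B at *
  generalize hC : (K ∩ L) \ (I ∩ J) = C at *
  generalize hP₁ : I \ (I ∩ J) ∩ (K \ (K ∩ L)) = P₁ at *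
  generalize hP₂ : I \ (I ∩ J) ∩ (L \ (K ∩ L)) = P₂ at *
  generalize hP₃ : J \ (I ∩ J) ∩ (K \ (K ∩ L)) = P₃ at *
  generalize hP₄ : J \ (I ∩ J) ∩ (L \ (K ∩ L)) = P₄ at *
  have hd := hdisj
  simp only [List.pairwise_cons, List.mem_cons, List.not_mem_nil, or_false, forall_eq_or_imp,
    forall_eq, List.Pairwise.nil, and_true] at hd
  obtain ⟨⟨d12, d13, d14, d1B, d1C⟩, ⟨d23, d24, d2B, d2C⟩, ⟨d34, d3B, d3C⟩, ⟨d4B, d4C⟩, dBC, -⟩ := hd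
  -- The four cardinality equations force `|P₁| = |P₄|`, `|P₂| = |P₃|` and `|B| = |C|`.
  have cI : B.card + (P₁.card + P₂.card) = m := by
    rw [← hI, eI, Finset.card_union_of_disjoint (Finset.disjoint_union_right.2 ⟨d1B.symm, d2B.symm⟩),
      Finset.card_union_of_disjoint d12]
  have cJ : B.card + (P₃.card + P₄.card) = m := by
    rw [← hJ, eJ, Finset.card_union_of_disjoint (Finset.disjoint_union_right.2 ⟨d3B.symm, d4B.symm⟩),
      Finset.card_union_of_disjoint d34]
  have cK : P₁.card + P₃.card + C.card = m := by
    rw [← hK, eK, Finset.card_union_of_disjoint (Finset.disjoint_union_left.2 ⟨d1C, d3C⟩),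
      Finset.card_union_of_disjoint d13]
  have cL : P₂.card + P₄.card + C.card = m := by
    rw [← hL, eL, Finset.card_union_of_disjoint (Finset.disjoint_union_left.2 ⟨d2C, d4C⟩),
      Finset.card_union_of_disjoint d24]
  rw [eI'] at h₁ h₂
  rw [eJ'] at h₂ h₃
  have hcard : (P₁ ∪ P₂).card = (P₃ ∪ P₄).card := by
    rw [Finset.card_union_of_disjoint d12, Finset.card_union_of_disjoint d34]; omega
  -- Transitivity through `P₁ ∪ P₂` needs that set nonempty, which holds because it is as large as
  -- `P₃ ∪ P₄`.
  have hBJ : SetLT B (P₃ ∪ P₄) := fun s hs t ht => by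
    obtain ⟨z, hz⟩ : (P₁ ∪ P₂).Nonempty := by
      rw [← Finset.card_pos, hcard, Finset.card_pos]; exact ⟨t, ht⟩
    exact (h₁ s hs z hz).trans (h₂ z hz t ht)
  have hIC : SetLT (P₁ ∪ P₂) C := fun s hs t ht => by
    obtain ⟨z, hz⟩ : (P₃ ∪ P₄).Nonempty := by
      rw [← Finset.card_pos, ← hcard, Finset.card_pos]; exact ⟨s, hs⟩
    exact (h₂ s hs z hz).trans (h₃ z hz t ht)
  rw [integral_minor_gram_mul_minor_gram_of_blocks (B := B) (C := C) (P₁ := P₁) (P₂ := P₂)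
    (P₃ := P₃) (P₄ := P₄) (b := B.card) (p := P₁.card) (q := P₂.card) rfl (by omega) rfl rfl
    (by omega) (by omega) cI hdisj eI eJ eK eL h₁ hBJ ?_ ?_ h₄ h₅ ?_ ?_ hI hJ hK hL,
    descFactorial_mul_sq_eq cI hmn]
  · intro s hs t ht
    rcases Finset.mem_union.1 hs with hs | hs
    · exact hIC s (Finset.mem_union_left _ hs) t ht
    · exact h₃ s (Finset.mem_union_left _ hs) t ht
  · intro s hs t ht
    rcases Finset.mem_union.1 hs with hs | hs
    · exact hIC s (Finset.mem_union_right _ hs) t ht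
    · exact h₃ s (Finset.mem_union_right _ hs) t ht
  · exact fun s hs t ht => h₂ s (Finset.mem_union_left _ hs) t (Finset.mem_union_left _ ht)
  · exact fun s hs t ht => h₂ s (Finset.mem_union_right _ hs) t (Finset.mem_union_right _ ht)

-- Induction on the number of common indices

universe u

/-- `E` is quantified inside the induction, in a fixed universe, since the inductive step passes to
the subspaces `(ℝ ∙ v)ᗮ`. -/
theorem integral_minor_gram_mul_minor_gram {ι : Type*} [Fintype ι] [LinearOrder ι] (a : ℕ) :
    ∀ (E : Type u) [NormedAddCommGroup E] [InnerProductSpace ℝ E]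
    [FiniteDimensional ℝ E] [MeasurableSpace E] [BorelSpace E] (m : ℕ)
    (_ : m ≤ Module.finrank ℝ E) (I J K L : Finset ι)
    (hI : I.card = m) (hJ : J.card = m) (hK : K.card = m) (hL : L.card = m)
    (_ : I ∆ J = K ∆ L) (_ : (I ∩ J ∩ K ∩ L).card = a)
    (_ : SetLT ((I ∩ J) \ (K ∩ L)) (I \ (I ∩ J))) (_ : SetLT (I \ (I ∩ J)) (J \ (I ∩ J)))
    (_ : SetLT (J \ (I ∩ J)) ((K ∩ L) \ (I ∩ J)))
    (_ : SetLT (I \ (I ∩ J) ∩ (K \ (K ∩ L))) (I \ (I ∩ J) ∩ (L \ (K ∩ L))))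
    (_ : SetLT (J \ (I ∩ J) ∩ (K \ (K ∩ L))) (J \ (I ∩ J) ∩ (L \ (K ∩ L)))),
    ∫ g : ι → E, minor (Matrix.gram ℝ g) I J hI hJ * minor (Matrix.gram ℝ g) K L hK hL
      ∂(Measure.pi fun _ => stdGaussian E) =
    ((Module.finrank ℝ E)! : ℝ) / ((Module.finrank ℝ E - m)! : ℝ)
      * (((Module.finrank ℝ E + 2)! : ℝ) / ((Module.finrank ℝ E + 2 - a)! : ℝ))
      * (((Module.finrank ℝ E - m + ((I ∩ J) \ (K ∩ L)).card)! : ℝ) /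
          ((Module.finrank ℝ E - m)! : ℝ))
      * ((I \ (I ∩ J) ∩ (K \ (K ∩ L))).card ! : ℝ)
      * ((I \ (I ∩ J) ∩ (L \ (K ∩ L))).card ! : ℝ) := by
  induction a with
  | zero =>
    intro E _ _ _ _ _ m hmn I J K L hI hJ hK hL h hA h₁ h₂ h₃ h₄ h₅
    exact integral_minor_gram_mul_minor_gram_of_inter_eq_empty hmn hI hJ hK hL h
      (Finset.card_eq_zero.1 hA) h₁ h₂ h₃ h₄ h₅
  | succ a ih =>
    intro E _ _ _ _ _ m hmn I J K L hI hJ hK hL h hA h₁ h₂ h₃ h₄ h₅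
    obtain ⟨x, hx⟩ : (I ∩ J ∩ K ∩ L).Nonempty := by rw [← Finset.card_pos]; omega
    have ham : a + 1 ≤ m := by
      rw [← hA, ← hL]; exact Finset.card_le_card Finset.inter_subset_right
    have hxe : (I ∩ J ∩ K ∩ L).erase x = I.erase x ∩ J.erase x ∩ K.erase x ∩ L.erase x := by
      ext y; simp only [Finset.mem_erase, Finset.mem_inter]; tauto
    have hA' := Finset.card_erase_of_mem hx
    rw [hxe, hA, Nat.add_sub_cancel] at hA'
    simp only [Finset.mem_inter] at hx
    obtain ⟨⟨⟨xI, xJ⟩, xK⟩, xL⟩ := hx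
    obtain ⟨k, rfl⟩ : ∃ k, m = k + 1 := ⟨m - 1, by omega⟩
    obtain ⟨n, hn⟩ : ∃ n, Module.finrank ℝ E = n + 1 := ⟨Module.finrank ℝ E - 1, by omega⟩
    have hcard {S : Finset ι} (hS : S.card = k + 1) (xS : x ∈ S) : (S.erase x).card = k := by
      rw [Finset.card_erase_of_mem xS, hS, Nat.add_sub_cancel]
    -- Removing `x` leaves unchanged every difference in the formula and the order hypotheses,
    -- because `x` lies in each subtracted intersection.
    have hdiff (S T U : Finset ι) (hT : x ∈ T) (hU : x ∈ U) : S.erase x \ (T.erase x ∩ U.erase x) =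
        S \ (T ∩ U) := by
      ext y
      by_cases hy : y = x
      · subst hy; simp [hT, hU]
      · simp [hy]
    have hdiff' (S T U V : Finset ι) (hU : x ∈ U) (hV : x ∈ V) :
        (S.erase x ∩ T.erase x) \ (U.erase x ∩ V.erase x) = (S ∩ T) \ (U ∩ V) := by
      ext y
      by_cases hy : y = x
      · subst hy; simp [hU, hV]
      · simp [hy]
    have hsymm (S T : Finset ι) (hS : x ∈ S) (hT : x ∈ T) : S.erase x ∆ T.erase x = S ∆ T := by
      ext y
      by_cases hy : y = x
      · subst hy; simp [Finset.mem_symmDiff, hS, hT]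
      · simp [Finset.mem_symmDiff, hy]
    rw [integral_minor_gram_mul_minor_gram_erase hI hJ hK hL h xI xJ xK xL (hcard hI xI)
      (hcard hJ xJ) (hcard hK xK) (hcard hL xL)
      (c := (n ! : ℝ) / ((n - k)! : ℝ) * (((n + 2)! : ℝ) / ((n + 2 - a)! : ℝ))
        * (((n - k + ((I ∩ J) \ (K ∩ L)).card)! : ℝ) / ((n - k)! : ℝ))
        * ((I \ (I ∩ J) ∩ (K \ (K ∩ L))).card ! : ℝ)
        * ((I \ (I ∩ J) ∩ (L \ (K ∩ L))).card ! : ℝ)) fun v hv => ?_]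
    · rw [hn, factorial_ratio_succ (by omega) (by omega)]
      push_cast
      ring
    · have : Fact (Module.finrank ℝ E = n + 1) := ⟨hn⟩
      have hfin : Module.finrank ℝ (ℝ ∙ v)ᗮ = n := Submodule.finrank_orthogonal_span_singleton hv
      have key := ih (ℝ ∙ v)ᗮ k (by omega) (I.erase x) (J.erase x) (K.erase x) (L.erase x)
        (hcard hI xI) (hcard hJ xJ) (hcard hK xK) (hcard hL xL)
        (by rw [hsymm I J xI xJ, hsymm K L xK xL, h]) hA'
      rw [hdiff' I J K L xK xL, hdiff' K L I J xI xJ, hdiff I I J xI xJ, hdiff J I J xI xJ,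
        hdiff K K L xK xL, hdiff L K L xK xL, hfin] at key
      exact key h₁ h₂ h₃ h₄ h₅

/-! ### From the Wishart law to Gram matrices of Gaussian rows -/

section Wishart

theorem measurePreserving_toLp_pi_gaussianReal (ι : Type*) [Fintype ι] :
    MeasurePreserving (MeasurableEquiv.toLp 2 (ι → ℝ)) (Measure.pi fun _ => gaussianReal 0 1)
      (stdGaussian (EuclideanSpace ℝ ι)) :=
  ⟨by fun_prop, map_pi_eq_stdGaussian⟩

/-- The rows of a matrix with independent standard Gaussian columns are independent and standard
Gaussian. -/
theorem measurePreserving_rows_stdGaussian (ι κ : Type*) [Fintype ι] [Fintype κ] :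
    MeasurePreserving
      (fun (x : κ → EuclideanSpace ℝ ι) (i : ι) => (WithLp.toLp 2 fun k => x k i : EuclideanSpace ℝ κ))
      (Measure.pi fun _ => stdGaussian (EuclideanSpace ℝ ι))
      (Measure.pi fun _ => stdGaussian (EuclideanSpace ℝ κ)) :=
  (measurePreserving_pi _ _ fun _ : ι => measurePreserving_toLp_pi_gaussianReal κ).comp
    ((measurePreserving_pi_swap (gaussianReal 0 1)).comp
      (measurePreserving_pi _ _ fun _ : κ => (measurePreserving_toLp_pi_gaussianReal ι).symm))

theorem columnMatrix_mul_transpose {ι : Type*} {n : ℕ} (x : Fin n → EuclideanSpace ℝ ι) :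
    columnMatrix x * (columnMatrix x)ᵀ =
      Matrix.gram ℝ fun i => (WithLp.toLp 2 fun k => x k i : EuclideanSpace ℝ (Fin n)) := by
  ext i j
  simp [Matrix.mul_apply, columnMatrix, Matrix.gram_apply, PiLp.inner_apply, mul_comm]

theorem measurable_matrix_entry {α β : Type*} (i : α) (j : β) :
    Measurable fun A : Matrix α β ℝ => A i j :=
  (measurable_pi_apply j).comp (measurable_pi_apply i)

theorem measurable_minor {ι : Type*} [LinearOrder ι] {m : ℕ} (I J : Finset ι)
    (hI : I.card = m) (hJ : J.card = m) : Measurable fun A : Matrix ι ι ℝ => minor A I J hI hJ := by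
  simp only [minor, Matrix.det_apply', Matrix.submatrix_apply]
  refine Finset.measurable_sum _ fun σ _ => ?_
  exact (Finset.measurable_prod _ fun i _ => measurable_matrix_entry _ _).const_mul _

theorem measurable_columnMatrix_mul_transpose {ι : Type*} {n : ℕ} :
    Measurable fun x : Fin n → EuclideanSpace ℝ ι => columnMatrix x * (columnMatrix x)ᵀ := by
  refine measurable_pi_iff.2 fun i => measurable_pi_iff.2 fun j => ?_
  simp only [Matrix.mul_apply, Matrix.transpose_apply, columnMatrix, Matrix.of_apply]
  fun_prop

end Wishart

theorem theorem4p5 {ι : Type*} [Fintype ι] [LinearOrder ι]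
    {Ω : Type*} [MeasurableSpace Ω] (P : Measure Ω) [IsProbabilityMeasure P]
    (n m : ℕ) (hmn : m ≤ n)
    (W : Ω → Matrix ι ι ℝ) (hW : HasLaw W (wishart n (1 : Matrix ι ι ℝ)) P)
    (I J K L : Finset ι)
    (hI : I.card = m) (hJ : J.card = m) (hK : K.card = m) (hL : L.card = m)
    (hIJKL : I ∆ J = K ∆ L)
    (I' J' K' L' : Finset ι)
    (hI' : I' = I \ (I ∩ J)) (hJ' : J' = J \ (I ∩ J))
    (hK' : K' = K \ (K ∩ L)) (hL' : L' = L \ (K ∩ L))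
    (h₁ : SetLT ((I ∩ J) \ (K ∩ L)) I') (h₂ : SetLT I' J')
    (h₃ : SetLT J' ((K ∩ L) \ (I ∩ J)))
    (h₄ : SetLT (I' ∩ K') (I' ∩ L')) (h₅ : SetLT (J' ∩ K') (J' ∩ L')) :
    Integrable (fun ω => minor (W ω) I J hI hJ * minor (W ω) K L hK hL) P ∧
    ∫ ω, minor (W ω) I J hI hJ * minor (W ω) K L hK hL ∂P =
      ((n)! : ℝ) / ((n - m)! : ℝ)
        * (((n + 2)! : ℝ) / ((n + 2 - (I ∩ J ∩ K ∩ L).card)! : ℝ))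
        * (((n - m + ((I ∩ J) \ (K ∩ L)).card)! : ℝ) / ((n - m)! : ℝ))
        * ((I' ∩ K').card ! : ℝ) * ((I' ∩ L').card ! : ℝ) := by
  subst hI' hJ' hK' hL'
  let R (x : Fin n → EuclideanSpace ℝ ι) (i : ι) : EuclideanSpace ℝ (Fin n) :=
    WithLp.toLp 2 fun k => x k i
  let F (A : Matrix ι ι ℝ) : ℝ := minor A I J hI hJ * minor A K L hK hL
  have hF : Measurable F := (measurable_minor I J hI hJ).mul (measurable_minor K L hK hL)
  have hR : MeasurePreserving R _ _ := measurePreserving_rows_stdGaussian ι (Fin n)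
  have hlaw : wishart n (1 : Matrix ι ι ℝ) =
      (Measure.pi fun _ : Fin n => stdGaussian (EuclideanSpace ℝ ι)).map
        fun x => columnMatrix x * (columnMatrix x)ᵀ := by
    simp only [wishart, multivariateGaussian_zero_one]
  have hm := measurable_columnMatrix_mul_transpose (ι := ι) (n := n)
  have hint : Integrable (fun g : ι → EuclideanSpace ℝ (Fin n) => F (Matrix.gram ℝ g))
      (Measure.pi fun _ => stdGaussian (EuclideanSpace ℝ (Fin n))) :=
    integrable_det_mul_det_gram _ _ _ _
  have hFR (x : Fin n → EuclideanSpace ℝ ι) :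
      F (columnMatrix x * (columnMatrix x)ᵀ) = F (Matrix.gram ℝ (R x)) := by
    rw [columnMatrix_mul_transpose]
  have hintW : Integrable F (wishart n (1 : Matrix ι ι ℝ)) := by
    rw [hlaw, integrable_map_measure hF.aestronglyMeasurable hm.aemeasurable, Function.comp_def]
    simp only [hFR]
    exact hR.integrable_comp_of_integrable hint
  refine ⟨?_, ?_⟩
  · rw [← hW.map_eq] at hintW
    exact hintW.comp_aemeasurable hW.aemeasurable
  · have key := integral_minor_gram_mul_minor_gram _ (EuclideanSpace ℝ (Fin n)) m (by simpa using hmn)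
      I J K L hI hJ hK hL hIJKL rfl h₁ h₂ h₃ h₄ h₅
    rw [finrank_euclideanSpace_fin] at key
    rw [← key]
    change ∫ ω, F (W ω) ∂P = _
    rw [← integral_map hW.aemeasurable hF.aestronglyMeasurable, hW.map_eq, hlaw,
      integral_map hm.aemeasurable hF.aestronglyMeasurable, ← hR.map_eq,
      integral_map hR.measurable.aemeasurable (by
        rw [hR.map_eq]; exact hint.aestronglyMeasurable)]
    exact integral_congr_ae (ae_of_all _ hFR)
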